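/- Let $q$ be a prime power, let $\Sigma$ be a canonical $\mathbb F_q$-subgeometry of $\mathrm{PG}(4,q^5)$ (a set of points projectively equivalent to the set of points with coordinates rational over $\mathbb F_q$), let $\Gamma$ be a plane of $\mathrm{PG}(4,q^5)$ with $\Gamma\cap\Sigma=\emptyset$, and let $\ell$ be a line disjoint from $\Gamma$. Let $\mathbb L\subseteq \ell\cong\mathrm{PG}(1,q^5)$ be the projection of $\Sigma$ from $\Gamma$ onto $\ell$. Assume that $\mathbb L$ is a maximum scattered $\mathbb F_q$-linear set, that is, $\mathbb L=L_U=\{\langle u\rangle_{\mathbb F_{q^5}}: u\in U,\ u\neq 0\}$ for some $\mathbb F_q$-subspace $U$ satisfying $\dim_{\mathbb F_q}(\langle v\rangle_{\mathbb F_{q^5}}\cap U)\le 1$ for every vector $v$, and of the largest dimension among the $\mathbb F_q$-subspaces with this property. Assume also that $\mathbb L$ is not of pseudoregulus type, that is, $\mathbb L$ is not projectively equivalent to $\{\langle(x,x^{q^s})\rangle_{\mathbb F_{q^5}}: x\in\mathbb F_{q^5}^*\}$ for any $s$ coprime to $5$. Let $\sigma\neq 1$ be an element of $\mathrm{P\Gamma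 L}(5,q^5)$ fixing $\Sigma$ pointwise. Then each of $\Gamma\cap\Gamma^{\sigma^4}$ and $\Gamma\cap\Gamma^{\sigma^3}$ consists of exactly one point; call these points $A$ and $B$, respectively. The four points $A,\ A_1=A^{\sigma},\ B,\ B_2=B^{\sigma^2}$ form a frame of the plane $\Gamma$; that is, they lie on $\Gamma$ and no three of them are collinear. -/

import Mathlib

open scoped LinearAlgebra.Projectivization

section LinearSets

variable {F K W : Type*} [Field F] [Field K] [Algebra F K]
  [AddCommGroup W] [Module F W] [Module K W] [IsScalarTower F K W]

/-- The `F`-linear set `L_U` of the projective space `ℙ K W` defined by an `F`-subspace `U` of `W`: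
the set of the points `⟨v⟩_K` with `v ∈ U`, `v ≠ 0`. -/
def linearSet (K : Type*) [Field K] [Module K W] (U : Submodule F W) : Set (ℙ K W) :=
  {P | ∃ v ∈ U, ∃ hv : v ≠ 0, P = Projectivization.mk K v hv}

/-- `U` is scattered: `dim_F (⟨v⟩_K ∩ U) ≤ 1` for every vector `v`. -/
def IsScatteredSubspace (K : Type*) [Field K] [Algebra F K] [Module K W] [IsScalarTower F K W]
    (U : Submodule F W) : Prop :=
  ∀ v : W, Module.finrank F ↥((Submodule.span K {v}).restrictScalars F ⊓ U) ≤ 1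

/-- `L` is a maximum scattered `F`-linear set: `L = L_U` with `U` scattered and of the highest
possible rank among the scattered `F`-subspaces. -/
def IsMaximumScattered (F : Type*) [Field F] [Algebra F K] [Module F W] [IsScalarTower F K W]
    (L : Set (ℙ K W)) : Prop :=
  ∃ U : Submodule F W, L = linearSet K U ∧ IsScatteredSubspace K U ∧
    ∀ U' : Submodule F W, IsScatteredSubspace K U' → Module.finrank F U' ≤ Module.finrank F U

/-- The linear set `L_f = {⟨(x, f x)⟩_K : x ∈ K, x ≠ 0}` of the projective line `ℙ K (K × K)`
defined by an `F`-linear map `f : K → K`. -/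
def linearSetOfMap (f : K →ₗ[F] K) : Set (ℙ K (K × K)) :=
  linearSet K f.graph

/-- `L` is of pseudoregulus type: with `q = |F|` and `n = [K : F]`, it is projectively equivalent
to `L_f` for `f x = x ^ (q ^ s)` and some `s` coprime to `n`. -/
def IsPseudoregulusType (F : Type*) [Field F] [Fintype F] [Algebra F K]
    (L : Set (ℙ K W)) : Prop :=
  ∃ s : ℕ, s.Coprime (Module.finrank F K) ∧ ∃ e : (K × K) ≃ₗ[K] W,
    L = Projectivization.map (e : (K × K) →ₗ[K] W) e.injective ''
      linearSetOfMap (((FiniteField.frobeniusAlgHom F K) ^ s).toLinearMap)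

end LinearSets

section Subgeometries

variable {K : Type*} [Field K]

/-- A canonical `F`-subgeometry of the projective space with coordinates in `Fin m → K`: a set
projectively equivalent to the set of the points with coordinates rational over `F`. -/
def IsCanonicalSubgeometry (F : Type*) [Field F] [Algebra F K] {m : ℕ}
    (S : Set (ℙ K (Fin m → K))) : Prop :=
  ∃ g : (Fin m → K) ≃ₗ[K] (Fin m → K),
    S = Projectivization.map (g : (Fin m → K) →ₗ[K] (Fin m → K)) g.injective ''
      linearSet K (LinearMap.range ((Algebra.linearMap F K).compLeft (Fin m)))

variable {V : Type*} [AddCommGroup V] [Module K V]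

/-- `σ` belongs to the group `PΓL` of the projective space `ℙ K V`: it is the permutation of the
points induced by a bijective semilinear map. -/
def IsSemilinearCollineation (σ : Equiv.Perm (ℙ K V)) : Prop :=
  ∃ (τ : K ≃+* K) (f : V →ₛₗ[(τ : K →+* K)] V) (hf : Function.Bijective f),
    ∀ P : ℙ K V, σ P = Projectivization.map f hf.injective P

/-- The projection of the point set `S` from the vertex `Γ` onto a subspace `L` complementary to
`Γ`: the points of `L` lying on `⟨Γ, P⟩` for some `P ∈ S`. -/
def projectionFrom (Γ L : Projectivization.Subspace K V) (S : Set (ℙ K V)) :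
    Set (ℙ K L.submodule) :=
  {Q | ∃ P ∈ S, Projectivization.map L.submodule.subtype L.submodule.injective_subtype Q ∈
    Γ ⊔ Projectivization.Subspace.span {P}}

/-- Four points form a frame of the plane `Γ`: they lie on `Γ` and no three of them are
collinear. -/
def IsFrameOfPlane (Γ : Projectivization.Subspace K V) (X : Fin 4 → ℙ K V) : Prop :=
  (∀ i, X i ∈ Γ) ∧ ∀ i j k : Fin 4, i ≠ j → i ≠ k → j ≠ k →
    ¬ Projectivization.IsCollinear ({X i, X j, X k} : Set (ℙ K V))

end Subgeometries

/-! The collineation is induced by a `τ`-semilinear map `ψ` with `ψ ^ 5 = 1`, whose fixed vectors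
form a five-dimensional `F`-space `R` defining the subgeometry. Let `G` be the vector space of the
vertex. Vectors `a` with `a` and `ψ a` in `G` give the points of the first intersection, and vectors
`b` with `b` and `ψ (ψ b)` in `G` those of the second. Scatteredness of the projection becomes
`IsScatteredVertex`: `G` contains no `u - c v` with `u`, `v` fixed, except trivially.

Existence of the two points is a dimension count, 3 + 3 > 5. If an intersection contained a line, a
second count inside `G` would give `r ≠ 0` with `r`, `ψ^k r`, `ψ^(2k) r` in `G`. The orbit of `r` is
then a basis, `G` is spanned by three consecutive orbit vectors, and the projection has the form `x
↦ (x, τ^k x)` up to equivalence. That is pseudoregulus type (`isPseudoregulusType_of_mem`), which is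
excluded.

For the frame, each triple has the form `a, ψ^k a, b` with `ψ^(2k) b` in `G`, for a suitable `k` in
1, 2, 3, 4, so one statement, `linearIndependent_of_mem`, covers all four. Were `b` on the line of
`a` and `ψ a` (writing `ψ` for `ψ^k`), `G` would contain a combination of `ψ² a` and `ψ³ a`. If one
coefficient vanishes, the previous case recurs; otherwise the projection is the linear set of `x ↦
ρ² x + δ ρ x` with `ρ = τ⁻¹` and `δ ≠ 0`, and it remains to see that this map is never scattered
(`exists_common_ratio`).

That is the arithmetic core. If `a ρ(a) = 1 + ρ³(a)`, the skew polynomial `ρ² + a ρ + 1` is a left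
factor of `ρ⁵ - 1`, hence has a kernel of `F`-dimension at least two. By Hilbert 90, `a` may be
replaced by `δ` when their norms agree, so a solution `a` of every nonzero norm is needed
(`exists_frieze_of_norm`). The relation is that of a Lyness 5-cycle. Solutions of norm `c` are
points of a curve on which Frobenius acts as the Lyness map or its square, and they are found by
comparing the degree of a polynomial with the number of its roots fixed by the square of Frobenius.
-/

/-! ### Points of Lyness curves with prescribed Frobenius action -/

open Polynomial in
/-- A polynomial all of whose roots `r` are simple, and for which the pair `r + φ r`, `r * φ r` is
determined by an element `κ r` fixed by the `q`-power map `φ`, has degree at most `2 q`. -/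
theorem natDegree_le_of_roots_quadratic {E : Type*} [Field E] [IsAlgClosed E]
    {φ : E →+* E} {q : ℕ} (hq : 2 ≤ q) (hφ : ∀ x, φ x = x ^ q) (f : E[X]) (hf : f ≠ 0)
    (hsimple : ∀ r, f.IsRoot r → ¬ f.derivative.IsRoot r)
    (S N κ : E → E) (hκ : ∀ r, f.IsRoot r → φ (κ r) = κ r)
    (hS : ∀ r, f.IsRoot r → r + φ r = S (κ r)) (hN : ∀ r, f.IsRoot r → r * φ r = N (κ r)) :
    f.natDegree ≤ 2 * q := by
  classical
  have hnodup : f.roots.Nodup := by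
    rw [Multiset.nodup_iff_count_le_one]
    intro r
    rw [count_roots]
    by_contra! h
    rw [one_lt_rootMultiplicity_iff_isRoot hf] at h
    exact hsimple r h.1 h.2
  have hcard : f.roots.toFinset.card = f.natDegree := by
    rw [Multiset.toFinset_card_of_nodup hnodup]
    exact (IsAlgClosed.splits f).natDegree_eq_card_roots.symm
  have hg : (X ^ q - X : E[X]) ≠ 0 := FiniteField.X_pow_card_sub_X_ne_zero E (by omega)
  have himage : (f.roots.toFinset.image κ).card ≤ q := by
    calc (f.roots.toFinset.image κ).card ≤ (X ^ q - X : E[X]).roots.toFinset.card := by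
          apply Finset.card_le_card
          intro s hs
          obtain ⟨r, hr, rfl⟩ := Finset.mem_image.1 hs
          have hr' : f.IsRoot r := by
            rw [Multiset.mem_toFinset, mem_roots hf] at hr; exact hr
          rw [Multiset.mem_toFinset, mem_roots hg]
          simp [← hφ, hκ r hr']
      _ ≤ (X ^ q - X : E[X]).natDegree :=
          (Multiset.toFinset_card_le _).trans (card_roots' _)
      _ = q := FiniteField.X_pow_card_sub_X_natDegree_eq E (by omega)
  rw [← hcard]
  refine (Finset.card_le_mul_card_image (f := κ) f.roots.toFinset 2 ?_).trans
    (Nat.mul_le_mul_left 2 himage)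
  intro s _
  -- Every root over `s` is a zero of this quadratic, since its coefficients are the sum and product
  -- of `r` and `φ r`.
  have hh : (X ^ 2 - C (S s) * X + C (N s) : E[X]).natDegree = 2 := by compute_degree!
  have hh0 : (X ^ 2 - C (S s) * X + C (N s) : E[X]) ≠ 0 := by
    intro h0; rw [h0] at hh; simp at hh
  calc (f.roots.toFinset.filter fun a => κ a = s).card
      ≤ (X ^ 2 - C (S s) * X + C (N s) : E[X]).roots.toFinset.card := by
        apply Finset.card_le_card
        intro r hr'
        obtain ⟨hr, hrs⟩ := Finset.mem_filter.1 hr'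
        rw [Multiset.mem_toFinset, mem_roots hf] at hr
        rw [Multiset.mem_toFinset, mem_roots hh0, IsRoot.def]
        simp only [eval_add, eval_sub, eval_pow, eval_X, eval_mul, eval_C]
        rw [← hrs, ← hS r hr, ← hN r hr]
        ring
    _ ≤ (X ^ 2 - C (S s) * X + C (N s) : E[X]).natDegree :=
        (Multiset.toFinset_card_le _).trans (card_roots' _)
    _ = 2 := hh

open Polynomial in
/-- Existence of a point on the Lyness curve `(1 + x) (1 + y) (1 + x + y) = c x y` on which the
`q`-power map acts as the Lyness map `(x, y) ↦ (y, (1 + y) / x)`. -/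
theorem exists_lyness_frobenius {E : Type*} [Field E] [IsAlgClosed E]
    {φ : E →+* E} {q : ℕ} (hq : 2 ≤ q) (hq0 : (q : E) = 0) (hφ : ∀ x, φ x = x ^ q)
    {c : E} (hc : φ c = c) (hc0 : c ≠ 0) :
    ∃ r : E, r * φ (φ r) = 1 + φ r ∧ (1 + r) * (1 + φ r) * (1 + r + φ r) = c * r * φ r := by
  by_contra! hno
  -- The curve equation with `y = φ x = x ^ q` substituted, so that only the second coordinate of
  -- the Lyness map remains to be matched.
  set f : E[X] := (1 + X) * (1 + X ^ q) * (1 + X + X ^ q) - C c * X * X ^ q with hf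
  have hev : ∀ r, f.eval r = (1 + r) * (1 + φ r) * (1 + r + φ r) - c * r * φ r := by
    intro r; simp [hf, hφ]
  have hdev : ∀ r, f.derivative.eval r =
      (1 + φ r) * (1 + r + φ r) + (1 + r) * (1 + φ r) - c * φ r := by
    have hX : derivative (X ^ q : E[X]) = 0 := by simp [derivative_X_pow, hq0]
    intro r; simp [hf, hφ, hX]
  have hdeg : f.natDegree = 2 * q + 1 := by
    have h1 : (1 + X : E[X]).natDegree = 1 := by compute_degree!
    have h2 : (1 + X ^ q : E[X]).natDegree = q := by
      rw [add_comm, ← C_1, natDegree_X_pow_add_C]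
    have h3 : (1 + X + X ^ q : E[X]).natDegree = q := by
      rw [natDegree_add_eq_right_of_natDegree_lt] <;> rw [natDegree_X_pow]
      rw [h1]; omega
    have hne : ∀ g : E[X], g.natDegree ≠ 0 → g ≠ 0 := by
      rintro g hg rfl; simp at hg
    have h4 : ((1 + X) * (1 + X ^ q) * (1 + X + X ^ q) : E[X]).natDegree = 2 * q + 1 := by
      rw [natDegree_mul (mul_ne_zero (hne _ (by omega)) (hne _ (by omega))) (hne _ (by omega)),
        natDegree_mul (hne _ (by omega)) (hne _ (by omega)), h1, h2, h3]
      ring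
    rw [hf, natDegree_sub_eq_left_of_natDegree_lt, h4]
    rw [h4]
    calc (C c * X * X ^ q : E[X]).natDegree ≤ 1 + q := by compute_degree
      _ < _ := by omega
  have hf0 : f ≠ 0 := by rintro h; rw [h] at hdeg; simp at hdeg
  have hroot : ∀ r, f.IsRoot r →
      (1 + r) * (1 + φ r) * (1 + r + φ r) = c * r * φ r := by
    intro r hr; rw [IsRoot.def, hev, sub_eq_zero] at hr; exact hr
  have hr0 : ∀ r, f.IsRoot r → r ≠ 0 ∧ φ r ≠ 0 ∧ 1 + r ≠ 0 ∧ 1 + φ r ≠ 0 ∧ 1 + r + φ r ≠ 0 := by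
    intro r hr
    have h := hroot r hr
    have h0 : r ≠ 0 := by rintro rfl; simp at h
    have h1 : φ r ≠ 0 := by simpa using h0
    have h2 : c * r * φ r ≠ 0 := by simp [hc0, h0]
    rw [← h] at h2
    simp only [ne_eq, mul_eq_zero, not_or] at h2
    tauto
  have hfix : ∀ r, f.IsRoot r → φ (φ r) = r := by
    intro r hr
    obtain ⟨h0, h1, h2, h3, h4⟩ := hr0 r hr
    by_contra hne
    have e1 := hroot r hr
    have e2 := congrArg φ e1
    simp only [map_mul, map_add, map_one, hc] at e2
    refine hno r ?_ e1
    -- The curve is symmetric, and for `y = φ r` it is a quadratic in `x` with product of roots `1 +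
    -- y`. Both `r` and `φ (φ r)` are zeros, so they coincide or are exchanged by the Lyness
    -- relation.
    have h5 : (φ (φ r) - r) * (1 + φ r) * (r * φ (φ r) - (1 + φ r)) = 0 := by
      linear_combination r * e2 - φ (φ r) * e1
    rcases mul_eq_zero.1 h5 with h | h
    · rcases mul_eq_zero.1 h with h | h
      · exact absurd (sub_eq_zero.1 h) hne
      · exact absurd h h3
    · exact sub_eq_zero.1 h
  -- With `s = r + φ r` and `n = r * φ r` the curve reads `(1 + s) (1 + s + n) = c n`, which
  -- determines `n` from `s`. This bounds the degree by `2 q`, against `2 q + 1`.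
  have hle := natDegree_le_of_roots_quadratic hq hφ f hf0 ?_ id
    (fun s => (1 + s) ^ 2 / (c - 1 - s)) (fun r => r + φ r) ?_ ?_ ?_
  · omega
  · intro r hr hd
    obtain ⟨h0, h1, h2, h3, h4⟩ := hr0 r hr
    have e1 := hroot r hr
    rw [IsRoot.def, hdev] at hd
    -- A multiple root turns out to satisfy `φ r = r` and `r ^ 2 = 1 + r`: it is a fixed point of
    -- the Lyness map, hence already a solution.
    have k1 : r ^ 2 = 1 + φ r := by
      have : (1 + φ r) * (1 + φ r - r ^ 2) = 0 := by
        linear_combination e1 - r * hd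
      simp only [mul_eq_zero, h3, false_or] at this
      linear_combination -this
    have k2 : (φ r) ^ 2 = 1 + r := by
      have := congrArg φ k1
      simpa [hfix r hr] using this
    have k3 : φ r = r := by
      have : (φ r - r) * (1 + r + φ r) = 0 := by linear_combination k2 - k1
      simp only [mul_eq_zero, h4, or_false] at this
      exact sub_eq_zero.1 this
    refine hno r ?_ e1
    rw [hfix r hr, ← k1]; ring
  · intro r hr
    simp [hfix r hr, add_comm]
  · intro r _; rfl
  · intro r hr
    have e1 := hroot r hr
    obtain ⟨h0, h1, h2, h3, h4⟩ := hr0 r hr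
    have : c - 1 - (r + φ r) ≠ 0 := by
      intro h
      have : (1 + r + φ r) * (1 + r + φ r) = 0 := by
        linear_combination e1 + r * φ r * h
      simp [h4] at this
    rw [eq_div_iff this]
    linear_combination -e1

open Polynomial in
/-- Existence of a point on the curve `x y (1 + x) (1 + y) = c (x y - 1)` on which the `q`-power map
acts as an automorphism of order five. -/
theorem exists_lyness_frobenius_sq {E : Type*} [Field E] [IsAlgClosed E]
    {φ : E →+* E} {q : ℕ} (hq : 2 ≤ q) (hq0 : (q : E) = 0) (hφ : ∀ x, φ x = x ^ q)
    {c : E} (hc : φ c = c) (hc0 : c ≠ 0) :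
    ∃ r : E, r * φ r * φ (φ r) * (1 + φ r) = c ∧
      r * φ r * (1 + r) * (1 + φ r) = c * (r * φ r - 1) := by
  by_contra! hno
  set f : E[X] := X * X ^ q * (1 + X) * (1 + X ^ q) - C c * (X * X ^ q - 1) with hf
  have hev : ∀ r, f.eval r = r * φ r * (1 + r) * (1 + φ r) - c * (r * φ r - 1) := by
    intro r; simp [hf, hφ]
  have hdev : ∀ r, f.derivative.eval r =
      φ r * (1 + r) * (1 + φ r) + r * φ r * (1 + φ r) - c * φ r := by
    have hX : derivative (X ^ q : E[X]) = 0 := by simp [derivative_X_pow, hq0]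
    intro r; simp [hf, hφ, hX]; ring
  have hdeg : f.natDegree = 2 * q + 2 := by
    have h1 : (1 + X : E[X]).natDegree = 1 := by compute_degree!
    have h2 : (1 + X ^ q : E[X]).natDegree = q := by
      rw [add_comm, ← C_1, natDegree_X_pow_add_C]
    have hne : ∀ g : E[X], g.natDegree ≠ 0 → g ≠ 0 := by
      rintro g hg rfl; simp at hg
    have h4 : (X * X ^ q * (1 + X) * (1 + X ^ q) : E[X]).natDegree = 2 * q + 2 := by
      rw [natDegree_mul (mul_ne_zero (mul_ne_zero X_ne_zero (pow_ne_zero _ X_ne_zero))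
        (hne _ (by omega))) (hne _ (by omega)), natDegree_mul (mul_ne_zero X_ne_zero
        (pow_ne_zero _ X_ne_zero)) (hne _ (by omega)), natDegree_mul X_ne_zero
        (pow_ne_zero _ X_ne_zero), h1, h2, natDegree_X, natDegree_X_pow]
      ring
    rw [hf, natDegree_sub_eq_left_of_natDegree_lt, h4]
    rw [h4]
    calc (C c * (X * X ^ q - 1) : E[X]).natDegree ≤ 1 + q := by compute_degree
      _ < _ := by omega
  have hf0 : f ≠ 0 := by rintro h; rw [h] at hdeg; simp at hdeg
  have hroot : ∀ r, f.IsRoot r →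
      r * φ r * (1 + r) * (1 + φ r) = c * (r * φ r - 1) := by
    intro r hr; rw [IsRoot.def, hev, sub_eq_zero] at hr; exact hr
  have hr0 : ∀ r, f.IsRoot r → r ≠ 0 ∧ φ r ≠ 0 := by
    intro r hr
    have h := hroot r hr
    have h0 : r ≠ 0 := by rintro rfl; simp [hc0] at h
    exact ⟨h0, by simpa using h0⟩
  have hfix : ∀ r, f.IsRoot r → φ (φ r) = r := by
    intro r hr
    obtain ⟨h0, h1⟩ := hr0 r hr
    by_contra hne
    have e1 := hroot r hr
    have e2 := congrArg φ e1
    simp only [map_mul, map_add, map_one, hc, map_sub] at e2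
    refine hno r ?_ e1
    -- Again a quadratic in `x` for `y = φ r`, now with product of roots `c / (y (1 + y))`.
    have h5 : (φ (φ r) - r) * (r * φ r * φ (φ r) * (1 + φ r) - c) = 0 := by
      linear_combination r * e2 - φ (φ r) * e1
    rcases mul_eq_zero.1 h5 with h | h
    · exact absurd (sub_eq_zero.1 h) hne
    · exact sub_eq_zero.1 h
  -- Here the product `n` is the parameter: the curve `n (1 + s + n) = c (n - 1)` is linear in the
  -- sum `s`. The bound `2 q` contradicts degree `2 q + 2`.
  have hle := natDegree_le_of_roots_quadratic hq hφ f hf0 ?_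
    (fun n => (c * (n - 1) - n * (1 + n)) / n) id (fun r => r * φ r) ?_ ?_ ?_
  · omega
  · intro r hr hd
    obtain ⟨h0, h1⟩ := hr0 r hr
    have e1 := hroot r hr
    rw [IsRoot.def, hdev] at hd
    have hd1 : (1 + 2 * r) * (1 + φ r) = c := by
      have : φ r * ((1 + 2 * r) * (1 + φ r) - c) = 0 := by linear_combination hd
      simpa [h1, sub_eq_zero] using this
    have h3 : 1 + φ r ≠ 0 := by
      intro h; rw [h, mul_zero] at hd1; exact hc0 hd1.symm
    have h2 : 1 + r ≠ 0 := by
      intro h; apply h3; have := congrArg φ h; simpa using this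
    have k1 : r ^ 2 * φ r = 1 + 2 * r := by
      have : (1 + φ r) * (r ^ 2 * φ r - (1 + 2 * r)) = 0 := by
        linear_combination -e1 + (r * φ r - 1) * hd1
      simp only [mul_eq_zero, h3, false_or] at this
      exact sub_eq_zero.1 this
    have k2 : (φ r) ^ 2 * r = 1 + 2 * φ r := by
      have := congrArg φ k1
      simpa only [map_mul, map_add, map_one, map_pow, map_ofNat, hfix r hr] using this
    have k3 : φ r = r := by
      have : (φ r - r) * (r * φ r - 2) = 0 := by linear_combination k2 - k1
      rcases mul_eq_zero.1 this with h | h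
      · exact sub_eq_zero.1 h
      · exfalso
        have : (1 : E) = 0 := by linear_combination r * h - k1
        simp at this
    rw [k3] at k1 hd1
    have k4 : r ^ 2 = 1 + r := by
      have : (1 + r) * (r ^ 2 - (1 + r)) = 0 := by linear_combination k1
      simp only [mul_eq_zero, h2, false_or] at this
      exact sub_eq_zero.1 this
    refine hno r ?_ e1
    rw [hfix r hr, k3]
    linear_combination hd1 + (1 + r) * k1
  · intro r hr
    simp [hfix r hr, mul_comm]
  · intro r hr
    have e1 := hroot r hr
    obtain ⟨h0, h1⟩ := hr0 r hr
    rw [eq_div_iff (mul_ne_zero h0 h1)]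
    linear_combination e1
  · intro r _; rfl

/-! ### Arithmetic of the cyclic extension of degree five -/

section CyclicQuintic

variable {F K : Type*} [Field F] [Fintype F] [Field K] [Algebra F K]

theorem orderOf_gal_eq_five (hFK : Module.finrank F K = 5) {ρ : K ≃ₐ[F] K} (hρ : ρ ≠ 1) :
    orderOf ρ = 5 := by
  have : FiniteDimensional F K := .of_finrank_eq_succ hFK
  have : Finite K := Module.finite_of_finite F
  have hcard : Nat.card (K ≃ₐ[F] K) = 5 := by rw [IsGalois.card_aut_eq_finrank, hFK]
  have : Fact (Nat.Prime 5) := ⟨by norm_num⟩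
  refine orderOf_eq_prime (p := 5) ?_ hρ
  rw [← hcard]; exact pow_card_eq_one'

theorem gal_iterate_five (hFK : Module.finrank F K = 5) (ρ : K ≃ₐ[F] K) (x : K) :
    ρ (ρ (ρ (ρ (ρ x)))) = x := by
  have h : ρ ^ 5 = 1 := by
    by_cases hρ : ρ = 1
    · rw [hρ, one_pow]
    · rw [← orderOf_gal_eq_five hFK hρ, pow_orderOf_eq_one]
  exact DFunLike.congr_fun h x

theorem mem_zpowers_gal (hFK : Module.finrank F K = 5) {ρ : K ≃ₐ[F] K} (hρ : ρ ≠ 1)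
    (g : K ≃ₐ[F] K) : g ∈ Subgroup.zpowers ρ := by
  have : FiniteDimensional F K := .of_finrank_eq_succ hFK
  have : Finite K := Module.finite_of_finite F
  have hcard : Nat.card (K ≃ₐ[F] K) = 5 := by rw [IsGalois.card_aut_eq_finrank, hFK]
  have : Fact (Nat.Prime 5) := ⟨by norm_num⟩
  exact mem_zpowers_of_prime_card hcard hρ

theorem exists_algebraMap_of_fixed (hFK : Module.finrank F K = 5) {ρ : K ≃ₐ[F] K} (hρ : ρ ≠ 1)
    {x : K} (hx : ρ x = x) : ∃ c : F, algebraMap F K c = x := by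
  have : FiniteDimensional F K := .of_finrank_eq_succ hFK
  have : Finite K := Module.finite_of_finite F
  refine (IsGalois.mem_range_algebraMap_iff_fixed x).2 fun g => ?_
  have h : Subgroup.zpowers ρ ≤ MulAction.stabilizer (K ≃ₐ[F] K) x := by
    rw [Subgroup.zpowers_le]; exact hx
  exact h (mem_zpowers_gal hFK hρ g)

/-- Dedekind's independence of characters for the powers of a generator. -/
theorem gal_dedekind (hFK : Module.finrank F K = 5) {ρ : K ≃ₐ[F] K} (hρ : ρ ≠ 1) (c : Fin 5 → K)
    (h : ∀ x, c 0 * x + c 1 * ρ x + c 2 * ρ (ρ x) + c 3 * ρ (ρ (ρ x))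
      + c 4 * ρ (ρ (ρ (ρ x))) = 0) (i : Fin 5) : c i = 0 := by
  have hinj : Function.Injective fun i : Fin 5 => ((ρ ^ (i : ℕ) : K ≃ₐ[F] K) : K →* K) := by
    intro i j hij
    have h1 : ρ ^ (i : ℕ) = ρ ^ (j : ℕ) := by
      ext x; exact DFunLike.congr_fun hij x
    have h2 := orderOf_gal_eq_five hFK hρ
    exact Fin.ext (pow_injOn_Iio_orderOf (by simp [h2]) (by simp [h2]) h1)
  have hli := (linearIndependent_monoidHom K K).comp _ hinj
  rw [Fintype.linearIndependent_iff] at hli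
  refine hli c ?_ i
  funext x
  simpa [Fin.sum_univ_five, pow_succ] using h x

theorem algebraMap_norm_gal (hFK : Module.finrank F K = 5) {ρ : K ≃ₐ[F] K} (hρ : ρ ≠ 1) (x : K) :
    algebraMap F K (Algebra.norm F x) = x * ρ x * ρ (ρ x) * ρ (ρ (ρ x)) * ρ (ρ (ρ (ρ x))) := by
  have : FiniteDimensional F K := .of_finrank_eq_succ hFK
  have : Finite K := Module.finite_of_finite F
  rw [Algebra.norm_eq_prod_automorphisms]
  have hinj : Function.Injective fun i : Fin 5 => ρ ^ (i : ℕ) := by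
    intro i j h1
    have h2 := orderOf_gal_eq_five hFK hρ
    exact Fin.ext (pow_injOn_Iio_orderOf (by simp [h2]) (by simp [h2]) h1)
  have hbij : Function.Bijective fun i : Fin 5 => ρ ^ (i : ℕ) := by
    rw [Fintype.bijective_iff_injective_and_card]
    refine ⟨hinj, ?_⟩
    rw [← Nat.card_eq_fintype_card (α := K ≃ₐ[F] K), IsGalois.card_aut_eq_finrank, hFK]
    simp
  rw [← hbij.prod_comp]
  simp [Fin.prod_univ_five]

open Polynomial in
theorem exists_algebraMap_of_pow_card {E : Type*} [Field E] [Algebra K E] [Fintype K] {r : E}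
    (hr : r ^ Fintype.card K = r) : ∃ a : K, algebraMap K E a = r := by
  have h1 : (X ^ Fintype.card K - X : K[X]).Splits := by
    rw [splits_iff_card_roots, FiniteField.roots_X_pow_card_sub_X,
      FiniteField.X_pow_card_sub_X_natDegree_eq K Fintype.one_lt_card]
    rfl
  have h2 : (X ^ Fintype.card K - X : K[X]) ≠ 0 :=
    FiniteField.X_pow_card_sub_X_ne_zero K Fintype.one_lt_card
  exact h1.mem_range_of_isRoot h2 (by simp [hr])

/-- An element of an extension of `K` fixed by the fifth power of the `|F|`-power map lies in `K`,
where this map is the Frobenius automorphism. -/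
theorem exists_of_frobenius_iterate_five (hFK : Module.finrank F K = 5) {E : Type*} [Field E]
    [Algebra K E] (φ : E →+* E) (hφ : ∀ x, φ x = x ^ Fintype.card F) {r : E}
    (hr : φ (φ (φ (φ (φ r)))) = r) : ∃ a : K, algebraMap K E a = r := by
  have : FiniteDimensional F K := .of_finrank_eq_succ hFK
  have : Finite K := Module.finite_of_finite F
  have := Fintype.ofFinite K
  apply exists_algebraMap_of_pow_card
  rw [Module.card_eq_pow_finrank (K := F) (V := K), hFK]
  simp only [hφ] at hr
  conv_rhs => rw [← hr]
  ring

theorem exists_frobenius (hFK : Module.finrank F K = 5) : ∃ Fr : K ≃ₐ[F] K, Fr ≠ 1 ∧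
    (∀ x, Fr x = x ^ Fintype.card F) := by
  have : FiniteDimensional F K := .of_finrank_eq_succ hFK
  have : Finite K := Module.finite_of_finite F
  refine ⟨FiniteField.frobeniusAlgEquivOfAlgebraic F K, ?_, fun x => rfl⟩
  intro h
  have h1 := FiniteField.orderOf_frobeniusAlgEquivOfAlgebraic F K
  rw [h, orderOf_one, hFK] at h1
  omega

theorem exists_gal_eq_frobenius_pow (hFK : Module.finrank F K = 5) {Fr : K ≃ₐ[F] K}
    (hFr : Fr ≠ 1) {ρ : K ≃ₐ[F] K} (hρ : ρ ≠ 1) :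
    ρ = Fr ∨ ρ = Fr ^ 2 ∨ ρ = Fr ^ 3 ∨ ρ = Fr ^ 4 := by
  classical
  have hord := orderOf_gal_eq_five hFK hFr
  have hfin : IsOfFinOrder Fr := orderOf_pos_iff.1 (by omega)
  obtain ⟨n, hn, hnρ⟩ := hfin.mem_zpowers_iff_mem_range_orderOf.1 (mem_zpowers_gal hFK hFr ρ)
    |> Finset.mem_image.1
  rw [hord, Finset.mem_range] at hn
  subst hnρ
  interval_cases n
  · simp at hρ
  · simp
  · simp
  · simp
  · simp

/-- Every nonzero element of `F` is the norm of some `a` with `a ρ(a) = 1 + ρ³(a)`. -/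
theorem exists_frieze_of_norm (hFK : Module.finrank F K = 5) {ρ : K ≃ₐ[F] K} (hρ : ρ ≠ 1)
    {c : F} (hc : c ≠ 0) :
    ∃ a : K, a * ρ a = 1 + ρ (ρ (ρ a)) ∧ Algebra.norm F a = c := by
  obtain ⟨Fr, hFr, hFrq⟩ := exists_frobenius (F := F) (K := K) hFK
  let E := AlgebraicClosure K
  let φ : E →+* E := (FiniteField.frobeniusAlgHom F E).toRingHom
  have hφ : ∀ x, φ x = x ^ Fintype.card F := fun x => rfl
  have hq : 2 ≤ Fintype.card F := Fintype.one_lt_card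
  have hq0 : ((Fintype.card F : ℕ) : E) = 0 := by
    have := congrArg (algebraMap F E) (FiniteField.cast_card_eq_zero F)
    rwa [map_natCast, map_zero] at this
  have hcφ : φ (algebraMap F E c) = algebraMap F E c :=
    (FiniteField.frobeniusAlgHom F E).commutes c
  have hc0 : algebraMap F E c ≠ 0 := by simpa using hc
  have hFrφ : ∀ x, φ (algebraMap K E x) = algebraMap K E (Fr x) := by
    intro x; rw [hφ, hFrq, map_pow]
  have hnorm : ∀ x, algebraMap K E (x * Fr x * Fr (Fr x) * Fr (Fr (Fr x)) * Fr (Fr (Fr (Fr x))))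
      = algebraMap F E c → Algebra.norm F x = c := by
    intro x hx
    rw [← algebraMap_norm_gal hFK hFr, ← IsScalarTower.algebraMap_apply] at hx
    exact (algebraMap F E).injective hx
  -- Case `ρ = Fr`. In a Lyness cycle `z₀, …, z₄` Frobenius is the shift by two; with `x = z₀`, `y =
  -- z₂` one has `z₁ = x y - 1`, and the product of the cycle is `x y (1 + x) (1 + y) / (x y - 1)`.
  have hA : ∃ a : K, a * Fr a = 1 + Fr (Fr (Fr a)) ∧ Algebra.norm F a = c := by
    obtain ⟨r, h1, h2⟩ := exists_lyness_frobenius_sq hq hq0 hφ hcφ hc0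
    have hne : r ≠ 0 ∧ φ r ≠ 0 ∧ φ (φ r) ≠ 0 ∧ 1 + φ r ≠ 0 := by
      rw [← h1] at hc0; simp only [ne_eq, mul_eq_zero, not_or] at hc0; tauto
    obtain ⟨n0, n1, n2, n3⟩ := hne
    have e1 : φ (φ r) * (r * φ r - 1) = 1 + r := by
      rw [← h1] at h2
      have : (r * φ r * (1 + φ r)) * (φ (φ r) * (r * φ r - 1) - (1 + r)) = 0 := by
        linear_combination -h2
      simp only [mul_eq_zero, n0, n1, n3, false_or] at this
      exact sub_eq_zero.1 this
    have e2 : φ (φ (φ r)) * (φ r * φ (φ r) - 1) = 1 + φ r := by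
      have := congrArg φ e1
      simpa only [map_mul, map_add, map_one, map_sub] using this
    have n4 : φ r * φ (φ r) - 1 ≠ 0 := by
      intro h; rw [h, mul_zero] at e2; exact n3 e2.symm
    have e3 : r * φ r = 1 + φ (φ (φ r)) := by
      have : (φ r * φ (φ r) - 1) * (r * φ r - (1 + φ (φ (φ r)))) = 0 := by
        linear_combination φ r * e1 - e2
      simp only [mul_eq_zero, n4, false_or] at this
      exact sub_eq_zero.1 this
    have e4 := congrArg φ e3
    have e5 := congrArg φ e4
    simp only [map_mul, map_add, map_one] at e4 e5
    -- The five-periodicity of the recurrence places `r` in `K`.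
    have hr : φ (φ (φ (φ (φ r)))) = r := by
      linear_combination e1 - e5 - φ (φ r) * e3
    obtain ⟨a, rfl⟩ := exists_of_frobenius_iterate_five hFK φ hφ hr
    refine ⟨a, ?_, ?_⟩
    · apply (algebraMap K E).injective
      simp only [hFrφ] at e3
      simpa using e3
    · apply hnorm
      simp only [hFrφ] at h1 e2 e4
      simp only [map_mul]
      linear_combination h1 + algebraMap K E a * algebraMap K E (Fr a) *
        algebraMap K E (Fr (Fr a)) * (e2 - algebraMap K E (Fr (Fr (Fr a))) * e4)
  -- Case `ρ = Fr ^ 2`, where Frobenius is the shift by one and the product of the cycle is `(1 + x)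
  -- (1 + y) (1 + x + y) / (x y)`.
  have hB : ∃ a : K, a * Fr (Fr a) = 1 + Fr a ∧ Algebra.norm F a = c := by
    obtain ⟨r, h1, h2⟩ := exists_lyness_frobenius hq hq0 hφ hcφ hc0
    have hne : r ≠ 0 := by rintro rfl; simp at h1
    have n1 : φ r ≠ 0 := by simpa using hne
    have n2 : φ (φ r) ≠ 0 := by simpa using n1
    have n3 : φ (φ (φ r)) ≠ 0 := by simpa using n2
    have e1 := congrArg φ h1
    have e2 := congrArg φ e1
    have e3 := congrArg φ e2
    simp only [map_mul, map_add, map_one] at e1 e2 e3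
    have k1 : φ r * φ (φ (φ (φ r))) = 1 + r := by
      have : (r * φ (φ r)) * (φ r * φ (φ (φ (φ r))) - (1 + r)) = 0 := by
        linear_combination r * φ r * e2 + r * e1 - r * h1
      simp only [mul_eq_zero, hne, n2, false_or] at this
      exact sub_eq_zero.1 this
    have hr : φ (φ (φ (φ (φ r)))) = r := by
      have : (φ r * φ (φ (φ r))) * (φ (φ (φ (φ (φ r)))) - r) = 0 := by
        linear_combination φ r * e3 + k1 - r * e1 - h1
      simp only [mul_eq_zero, n1, n3, false_or] at this
      exact sub_eq_zero.1 this
    obtain ⟨a, rfl⟩ := exists_of_frobenius_iterate_five hFK φ hφ hr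
    simp only [hFrφ] at h1 h2 k1 e1 e2 n1
    refine ⟨a, ?_, ?_⟩
    · apply (algebraMap K E).injective
      simpa using h1
    · apply hnorm
      simp only [map_mul]
      generalize algebraMap K E a = r0 at *
      generalize algebraMap K E (Fr a) = r1 at *
      generalize algebraMap K E (Fr (Fr a)) = r2 at *
      generalize algebraMap K E (Fr (Fr (Fr a))) = r3 at *
      generalize algebraMap K E (Fr (Fr (Fr (Fr a)))) = r4 at *
      have k2 : r0 * r1 * r3 = 1 + r0 + r1 := by linear_combination r0 * e1 + h1
      have : r0 * r1 * (r0 * r1 * r2 * r3 * r4 - algebraMap F E c) = 0 := by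
        linear_combination (r0 * r2) * (r1 * r4) * k2 + (r0 * r2) * (1 + r0 + r1) * k1
          + (1 + r0 + r1) * (1 + r0) * h1 + h2
      simp only [mul_eq_zero, hne, n1, false_or] at this
      exact sub_eq_zero.1 this
  have h5 := gal_iterate_five hFK Fr
  have hnFr : ∀ x, Algebra.norm F (Fr x) = Algebra.norm F x := by
    intro x; exact Algebra.norm_eq_of_algEquiv Fr x
  obtain ⟨a, ha, han⟩ := hA
  obtain ⟨b, hb, hbn⟩ := hB
  -- Replacing `ρ` by its inverse preserves the relation after a shift of the solution, so the two
  -- cases above suffice.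
  rcases exists_gal_eq_frobenius_pow hFK hFr hρ with rfl | rfl | rfl | rfl
  · exact ⟨a, ha, han⟩
  · refine ⟨b, ?_, hbn⟩
    simp [pow_succ, h5, hb]
  · refine ⟨Fr (Fr b), ?_, by rw [hnFr, hnFr, hbn]⟩
    simp [pow_succ, h5]
    linear_combination hb
  · refine ⟨Fr a, ?_, by rw [hnFr, han]⟩
    simp [pow_succ, h5]
    linear_combination ha

/-- Hilbert's Theorem 90. -/
theorem exists_mul_eq_of_prod_eq_one (hFK : Module.finrank F K = 5) {ρ : K ≃ₐ[F] K} (hρ : ρ ≠ 1)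
    {p : K} (hp : p * ρ p * ρ (ρ p) * ρ (ρ (ρ p)) * ρ (ρ (ρ (ρ p))) = 1) :
    ∃ u : K, u ≠ 0 ∧ p * ρ u = u := by
  have h5 := gal_iterate_five hFK ρ
  set D : K → K := fun x => x + p * ρ x + p * ρ p * ρ (ρ x) + p * ρ p * ρ (ρ p) * ρ (ρ (ρ x))
    + p * ρ p * ρ (ρ p) * ρ (ρ (ρ p)) * ρ (ρ (ρ (ρ x))) with hD
  obtain ⟨x, hx⟩ : ∃ x, D x ≠ 0 := by
    by_contra! h
    have := gal_dedekind hFK hρ ![1, p, p * ρ p, p * ρ p * ρ (ρ p),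
      p * ρ p * ρ (ρ p) * ρ (ρ (ρ p))] (by intro x; simpa [hD] using h x) 0
    simp at this
  refine ⟨D x, hx, ?_⟩
  simp only [hD, map_add, map_mul, h5]
  linear_combination x * hp

/-- The operators `x ↦ ρ²(x) + δ ρ(x)`, `δ ≠ 0`, are not scattered. -/
theorem exists_common_ratio (hFK : Module.finrank F K = 5) {ρ : K ≃ₐ[F] K} (hρ : ρ ≠ 1)
    {δ : K} (hδ : δ ≠ 0) : ∃ y w t : K, y ≠ 0 ∧ ρ w ≠ w ∧ ρ (ρ y) + δ * ρ y + t * y = 0 ∧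
      ρ (ρ (w * y)) + δ * ρ (w * y) + t * (w * y) = 0 := by
  have : FiniteDimensional F K := .of_finrank_eq_succ hFK
  have : Finite K := Module.finite_of_finite F
  have h5 := gal_iterate_five hFK ρ
  have hNδ : Algebra.norm F δ ≠ 0 := Algebra.norm_ne_zero_iff.2 hδ
  obtain ⟨a, ha, haN⟩ := exists_frieze_of_norm hFK hρ hNδ
  have ha0 : a ≠ 0 := by
    rw [← haN] at hNδ; exact Algebra.norm_ne_zero_iff.1 hNδ
  have ha4 := congrArg (fun x => ρ (ρ (ρ (ρ x)))) ha
  simp only [map_mul, map_add, map_one, h5] at ha4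
  set P : K → K := fun x => ρ (ρ (ρ x)) - ρ (ρ (ρ a)) * ρ (ρ x) + a * ρ x - x with hP
  have hLP : ∀ x, ρ (ρ (P x)) + a * ρ (P x) + P x = 0 := by
    intro x
    simp only [hP, map_sub, map_add, map_mul, h5]
    linear_combination ρ (ρ x) * ha - ρ (ρ (ρ x)) * ha4
  have hP0 : ∃ x, P x ≠ 0 := by
    by_contra! h
    have := gal_dedekind hFK hρ ![-1, a, -ρ (ρ (ρ a)), 1, 0]
      (by intro x; have := h x; simp [hP] at this ⊢; linear_combination this) 3
    simp at this
  obtain ⟨x₀, hx₀⟩ := hP0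
  -- The image of `P` is not an `F`-line: otherwise a nonzero combination of `1, ρ, …, ρ⁴`, with
  -- leading coefficient `P x₀`, would vanish identically.
  have hP1 : ∃ x, ρ (P x / P x₀) ≠ P x / P x₀ := by
    by_contra! h
    have h0 : ρ (P x₀) ≠ 0 := by simpa using hx₀
    have hh : ∀ x, P x₀ * ρ (P x) - ρ (P x₀) * P x = 0 := by
      intro x
      have := h x
      rw [map_div₀, div_eq_div_iff h0 hx₀] at this
      linear_combination this
    have := gal_dedekind hFK hρ ![ρ (P x₀), - P x₀ - ρ (P x₀) * a,
      P x₀ * ρ a + ρ (P x₀) * ρ (ρ (ρ a)), - P x₀ * ρ (ρ (ρ (ρ a))) - ρ (P x₀), P x₀]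
      (by
        intro x
        have := hh x
        generalize P x₀ = p at *
        simp only [hP, map_sub, map_add, map_mul] at this
        simp
        linear_combination this) 4
    simp [hx₀] at this
  obtain ⟨x₁, hx₁⟩ := hP1
  have hN1 : δ / a * ρ (δ / a) * ρ (ρ (δ / a)) * ρ (ρ (ρ (δ / a))) *
      ρ (ρ (ρ (ρ (δ / a)))) = 1 := by
    have h := algebraMap_norm_gal hFK hρ δ
    rw [← haN, algebraMap_norm_gal hFK hρ a] at h
    have h0 : algebraMap F K (Algebra.norm F a) ≠ 0 := by rw [haN]; simpa using hNδ
    rw [algebraMap_norm_gal hFK hρ a] at h0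
    simp only [map_div₀, div_mul_div_comm]
    rw [← h, div_self h0]
  -- Equality of norms gives `l` with `δ ρ²(l) = a ρ(l)`; dividing the kernel by `l` then turns the
  -- coefficient `a` into `δ` and the constant term 1 into `l / ρ²(l)`.
  obtain ⟨u, hu0, hu⟩ := exists_mul_eq_of_prod_eq_one hFK hρ hN1
  obtain ⟨l, hl⟩ : ∃ l, ρ l = u := ρ.surjective _
  have hl0 : l ≠ 0 := by rintro rfl; simp at hl; exact hu0 hl.symm
  have hl1 : ρ l ≠ 0 := by simpa using hl0
  have hl2 : ρ (ρ l) ≠ 0 := by simpa using hl1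
  rw [← hl] at hu
  field_simp at hu
  have key : ∀ x, ρ (ρ (P x / l)) + δ * ρ (P x / l) + l / ρ (ρ l) * (P x / l) = 0 := by
    intro x
    have := hLP x
    simp only [map_div₀]
    field_simp
    linear_combination ρ l * this + ρ (P x) * hu
  refine ⟨P x₀ / l, P x₁ / P x₀, l / ρ (ρ l), div_ne_zero hx₀ hl0, hx₁, key x₀, ?_⟩
  have : P x₁ / P x₀ * (P x₀ / l) = P x₁ / l := by field_simp
  rw [this]
  exact key x₁

end CyclicQuintic

/-! ### Semilinear maps of order five and scattered vertices -/

section SemilinearAut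

variable {F K V : Type*} [Field F] [Field K] [Algebra F K]
  [AddCommGroup V] [Module F V] [Module K V]

/-- `ψ` is a `τ`-semilinear bijection of order five of the `K`-space `V`. -/
structure IsSemilinearAut (τ : K ≃ₐ[F] K) (ψ : Module.End F V) : Prop where
  ne_one : τ ≠ 1
  map_smul : ∀ (c : K) (v : V), ψ (c • v) = τ c • ψ v
  pow_five : ψ ^ 5 = 1

/-- The `K`-subspace `G` does not contain a difference `u - c v` of vectors fixed by `ψ`, `v ≠ 0`,
unless `u = c v`: this means that the projection of the fixed vectors from `G` is a scattered
subspace of rank five. -/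
def IsScatteredVertex (ψ : Module.End F V) (G : Submodule K V) : Prop :=
  ∀ (u v : V) (c : K), ψ u = u → ψ v = v → v ≠ 0 → u - c • v ∈ G → u = c • v

namespace IsSemilinearAut

variable {τ : K ≃ₐ[F] K} {ψ : Module.End F V}

theorem iterate_five (h : IsSemilinearAut τ ψ) (v : V) : ψ (ψ (ψ (ψ (ψ v)))) = v :=
  DFunLike.congr_fun h.pow_five v

theorem injective (h : IsSemilinearAut τ ψ) : Function.Injective ψ := by
  intro u v huv
  rw [← h.iterate_five u, huv, h.iterate_five]

/-- The span of the first `n` vectors of an orbit is invariant if it contains the next one. -/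
theorem krylov_invariant (h : IsSemilinearAut τ ψ) (a : V) {n : ℕ}
    (hn : (ψ ^ n) a ∈ Submodule.span K (Set.range fun i : Fin n => (ψ ^ (i : ℕ)) a)) :
    ∀ w ∈ Submodule.span K (Set.range fun i : Fin n => (ψ ^ (i : ℕ)) a),
      ψ w ∈ Submodule.span K (Set.range fun i : Fin n => (ψ ^ (i : ℕ)) a) := by
  intro w hw
  induction hw using Submodule.span_induction with
  | mem x hx =>
    obtain ⟨i, rfl⟩ := hx
    simp only
    rw [← Module.End.mul_apply, ← pow_succ']
    rcases Nat.lt_or_ge (i + 1) n with hi | hi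
    · exact Submodule.subset_span ⟨⟨i + 1, hi⟩, rfl⟩
    · have : (i : ℕ) + 1 = n := by omega
      rwa [this]
  | zero => simp
  | add x y _ _ hx hy => rw [map_add]; exact Submodule.add_mem _ hx hy
  | smul c x _ hx => rw [h.map_smul]; exact Submodule.smul_mem _ _ hx

variable [Fintype F]

theorem pow (h : IsSemilinearAut τ ψ) (hFK : Module.finrank F K = 5) {k : ℕ} (hk : ¬ 5 ∣ k) :
    IsSemilinearAut (τ ^ k) (ψ ^ k) where
  ne_one := by
    rwa [ne_eq, ← orderOf_dvd_iff_pow_eq_one, orderOf_gal_eq_five hFK h.ne_one]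
  map_smul := by
    clear hk
    induction k with
    | zero => simp
    | succ k ih =>
      intro c v
      rw [pow_succ', Module.End.mul_apply, ih, h.map_smul, pow_succ']
      rfl
  pow_five := by rw [← pow_mul, mul_comm, pow_mul, h.pow_five, one_pow]

/-- Galois descent: a subspace invariant under `ψ` is spanned by vectors fixed by `ψ`. -/
theorem le_span_fixed (h : IsSemilinearAut τ ψ) (hFK : Module.finrank F K = 5)
    (W : Submodule K V) (hW : ∀ w ∈ W, ψ w ∈ W) :
    W ≤ Submodule.span K {u | u ∈ W ∧ ψ u = u} := by
  intro w hw
  by_contra hnot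
  obtain ⟨f, hfw, hf⟩ := Submodule.exists_le_ker_of_notMem hnot
  have key : ∀ x : K, f w * x + f (ψ w) * τ x + f (ψ (ψ w)) * τ (τ x)
      + f (ψ (ψ (ψ w))) * τ (τ (τ x)) + f (ψ (ψ (ψ (ψ w)))) * τ (τ (τ (τ x))) = 0 := by
    intro x
    -- The trace of `x • w` over the powers of `ψ` is fixed. A functional killing all fixed vectors
    -- of `W` kills these traces for all `x`, and independence of characters gives `f w = 0`.
    have h1 : x • w + ψ (x • w) + ψ (ψ (x • w)) + ψ (ψ (ψ (x • w)))
        + ψ (ψ (ψ (ψ (x • w)))) ∈ Submodule.span K {u | u ∈ W ∧ ψ u = u} := by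
      apply Submodule.subset_span
      have h0 := W.smul_mem x hw
      have h1 := hW _ h0
      have h2 := hW _ h1
      have h3 := hW _ h2
      have h4 := hW _ h3
      refine ⟨W.add_mem (W.add_mem (W.add_mem (W.add_mem h0 h1) h2) h3) h4, ?_⟩
      simp only [map_add, h.iterate_five]
      abel
    have h2 := hf h1
    simp only [LinearMap.mem_ker, h.map_smul, map_add, _root_.map_smul, smul_eq_mul] at h2
    linear_combination h2
  exact hfw (gal_dedekind hFK h.ne_one ![f w, f (ψ w), f (ψ (ψ w)), f (ψ (ψ (ψ w))),
    f (ψ (ψ (ψ (ψ w))))] key 0)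

/-- By descent a nonzero invariant subspace contains a nonzero fixed vector, and a scattered vertex
contains none (take `c = 0`). -/
theorem eq_bot_of_le (h : IsSemilinearAut τ ψ) (hFK : Module.finrank F K = 5)
    {G W : Submodule K V} (hG : IsScatteredVertex ψ G) (hW : ∀ w ∈ W, ψ w ∈ W) (hWG : W ≤ G) :
    W = ⊥ := by
  rw [eq_bot_iff]
  refine (h.le_span_fixed hFK W hW).trans ?_
  rw [Submodule.span_le]
  rintro u ⟨hu, hu'⟩
  by_contra hne
  have := hG u u 0 hu' hu' hne (by simpa using hWG hu)
  simp at this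
  exact hne this

/-- Modulo `G` the space `W` has dimension at most one, so any two of its fixed vectors are
proportional modulo `G`; scatteredness makes them proportional. Descent does the rest. -/
theorem exists_le_span_singleton (h : IsSemilinearAut τ ψ) (hFK : Module.finrank F K = 5)
    {G W : Submodule K V} (hG : IsScatteredVertex ψ G) (hW : ∀ w ∈ W, ψ w ∈ W) {x : V}
    (hWG : W ≤ G ⊔ Submodule.span K {x}) : ∃ v : V, W ≤ Submodule.span K {v} := by
  by_cases hex : ∃ v ∈ W, ψ v = v ∧ v ≠ 0
  · obtain ⟨v, hvW, hv, hv0⟩ := hex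
    refine ⟨v, (h.le_span_fixed hFK W hW).trans ?_⟩
    rw [Submodule.span_le]
    rintro u ⟨hu, hu'⟩
    obtain ⟨g, hg, y, hy, hgy⟩ := Submodule.mem_sup.1 (hWG hvW)
    obtain ⟨b, rfl⟩ := Submodule.mem_span_singleton.1 hy
    obtain ⟨g', hg', y', hy', hgy'⟩ := Submodule.mem_sup.1 (hWG hu)
    obtain ⟨b', rfl⟩ := Submodule.mem_span_singleton.1 hy'
    have hb : b ≠ 0 := by
      rintro rfl
      have := hG v v 0 hv hv hv0 (by rw [← hgy]; simpa using hg)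
      simp at this
      exact hv0 this
    have : u - (b' / b) • v ∈ G := by
      have : u - (b' / b) • v = g' - (b' / b) • g := by
        rw [← hgy, ← hgy', smul_add, smul_smul, div_mul_cancel₀ _ hb]
        abel
      rw [this]
      exact G.sub_mem hg' (G.smul_mem _ hg)
    rw [hG u v _ hu' hv hv0 this]
    exact Submodule.smul_mem _ _ (Submodule.mem_span_singleton_self v)
  · refine ⟨0, (h.le_span_fixed hFK W hW).trans ?_⟩
    rw [Submodule.span_le]
    rintro u ⟨hu, hu'⟩
    by_contra hne
    exact hex ⟨u, hu, hu', fun h0 => hne (by simp [h0])⟩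

theorem linearIndependent_orbit (h : IsSemilinearAut τ ψ) (hFK : Module.finrank F K = 5)
    {G : Submodule K V} (hG : IsScatteredVertex ψ G) {a : V} (ha : a ≠ 0) (ha0 : a ∈ G)
    (ha1 : ψ a ∈ G) {α β : K} (hαβ : α ≠ 0 ∨ β ≠ 0) (hab : α • ψ (ψ a) + β • ψ (ψ (ψ a)) ∈ G) :
    LinearIndependent K fun i : Fin 5 => (ψ ^ (i : ℕ)) a := by
  set W : ℕ → Submodule K V :=
    fun n => Submodule.span K (Set.range fun i : Fin n => (ψ ^ (i : ℕ)) a) with hWdef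
  have haW : ∀ n i, i < n → (ψ ^ i) a ∈ W n := fun n i hi =>
    Submodule.subset_span ⟨⟨i, hi⟩, rfl⟩
  have hWle : ∀ n (H : Submodule K V), (∀ i < n, (ψ ^ i) a ∈ H) → W n ≤ H := by
    intro n H hH
    rw [hWdef, Submodule.span_le]
    rintro _ ⟨i, rfl⟩
    exact hH i i.2
  have hinG : ∀ n, 0 < n → W n ≤ G → (ψ ^ n) a ∉ W n := by
    intro n hn hle hmem
    have := h.eq_bot_of_le hFK hG (h.krylov_invariant a hmem) hle
    have h0 : (ψ ^ 0) a ∈ W n := haW n 0 hn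
    rw [hWdef] at h0
    simp only [this, Submodule.mem_bot] at h0
    exact ha (by simpa using h0)
  have h1 : (ψ ^ 1) a ∉ W 1 := by
    refine hinG 1 one_pos (hWle 1 G fun i hi => ?_)
    interval_cases i
    simpa using ha0
  have h2 : (ψ ^ 2) a ∉ W 2 := by
    refine hinG 2 two_pos (hWle 2 G fun i hi => ?_)
    interval_cases i
    · simpa using ha0
    · simpa using ha1
  -- The combination in `G` expresses one of `ψ² a`, `ψ³ a` through the other modulo `G`, so one
  -- extra vector suffices.
  have hsup : ∃ x, W 4 ≤ G ⊔ Submodule.span K {x} := by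
    by_cases hβ : β = 0
    · subst hβ
      have hα : α ≠ 0 := by simpa using hαβ
      have ha2 : ψ (ψ a) ∈ G := by
        rw [zero_smul, add_zero] at hab
        exact (G.smul_mem_iff hα).1 hab
      refine ⟨ψ (ψ (ψ a)), hWle 4 _ fun i hi => ?_⟩
      interval_cases i
      · exact Submodule.mem_sup_left (by simpa using ha0)
      · exact Submodule.mem_sup_left (by simpa using ha1)
      · exact Submodule.mem_sup_left ha2
      · exact Submodule.mem_sup_right (Submodule.mem_span_singleton_self _)
    · refine ⟨ψ (ψ a), hWle 4 _ fun i hi => ?_⟩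
      interval_cases i
      · exact Submodule.mem_sup_left (by simpa using ha0)
      · exact Submodule.mem_sup_left (by simpa using ha1)
      · exact Submodule.mem_sup_right (Submodule.mem_span_singleton_self _)
      · have h3 : (ψ ^ 3) a = β⁻¹ • (α • ψ (ψ a) + β • ψ (ψ (ψ a))) + (-(β⁻¹ * α)) • ψ (ψ a) := by
          rw [smul_add, smul_smul, smul_smul, inv_mul_cancel₀ hβ, one_smul, neg_smul]
          have : (ψ ^ 3) a = ψ (ψ (ψ a)) := rfl
          rw [this]; abel
        rw [h3]
        exact Submodule.add_mem_sup (G.smul_mem _ hab)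
          (Submodule.smul_mem _ _ (Submodule.mem_span_singleton_self _))
  -- If the orbit closed up here, `W n` would be invariant, hence of dimension at most one, although
  -- `a` and `ψ a` are independent.
  have hbig : ∀ n, 2 ≤ n → n ≤ 4 → (ψ ^ n) a ∉ W n := by
    intro n hn hn4 hmem
    obtain ⟨x, hx⟩ := hsup
    have hW4 : W n ≤ W 4 := hWle n _ fun i hi => haW 4 i (by omega)
    obtain ⟨v, hv⟩ := h.exists_le_span_singleton hFK hG (h.krylov_invariant a hmem)
      (hW4.trans hx)
    obtain ⟨c, hc⟩ := Submodule.mem_span_singleton.1 (hv (haW n 0 (by omega)))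
    obtain ⟨d, hd⟩ := Submodule.mem_span_singleton.1 (hv (haW n 1 (by omega)))
    have hc0 : c ≠ 0 := by
      rintro rfl; simp at hc; exact ha hc.symm
    apply h1
    have : (ψ ^ 1) a = (d * c⁻¹) • (ψ ^ 0) a := by
      rw [← hc, ← hd, smul_smul, mul_assoc, inv_mul_cancel₀ hc0, mul_one]
    rw [this]
    exact Submodule.smul_mem _ _ (haW 1 0 one_pos)
  have hli : ∀ n, n ≤ 5 → LinearIndependent K fun i : Fin n => (ψ ^ (i : ℕ)) a := by
    intro n
    induction n with
    | zero => intro _; exact linearIndependent_empty_type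
    | succ n ih =>
      intro hn
      rw [linearIndependent_finSucc']
      refine ⟨ih (by omega), ?_⟩
      change (ψ ^ n) a ∉ W n
      rcases n with _ | _ | n
      · simpa [hWdef] using ha
      · exact h1
      · exact hbig _ (by omega) (by omega)
  exact hli 5 le_rfl

/-- The fixed vectors of `ψ` in terms of a basis which is an orbit of `ψ`. -/
theorem fixed_iff (h : IsSemilinearAut τ ψ) (hFK : Module.finrank F K = 5)
    (hV : Module.finrank K V = 5) {a : V}
    (ha : LinearIndependent K fun i : Fin 5 => (ψ ^ (i : ℕ)) a) {u : V} :
    ψ u = u ↔ ∃ x : K, u = x • a + τ x • ψ a + τ (τ x) • ψ (ψ a) + τ (τ (τ x)) • ψ (ψ (ψ a))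
      + τ (τ (τ (τ x))) • ψ (ψ (ψ (ψ a))) := by
  constructor
  · intro hu
    have : FiniteDimensional K V := .of_finrank_eq_succ hV
    have hspan := ha.span_eq_top_of_card_eq_finrank' (by simp [hV])
    have hmem : u ∈ Submodule.span K (Set.range fun i : Fin 5 => (ψ ^ (i : ℕ)) a) := by
      rw [hspan]; trivial
    obtain ⟨c, hc⟩ := (Submodule.mem_span_range_iff_exists_fun K).1 hmem
    have e1 : u = c 0 • a + c 1 • ψ a + c 2 • ψ (ψ a) + c 3 • ψ (ψ (ψ a))
        + c 4 • ψ (ψ (ψ (ψ a))) := by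
      rw [← hc, Fin.sum_univ_five]; rfl
    have e2 : u = τ (c 4) • a + τ (c 0) • ψ a + τ (c 1) • ψ (ψ a) + τ (c 2) • ψ (ψ (ψ a))
        + τ (c 3) • ψ (ψ (ψ (ψ a))) := by
      conv_lhs => rw [← hu, e1]
      simp only [map_add, h.map_smul, h.iterate_five]
      abel
    have hzero : ∑ i : Fin 5, (![c 0 - τ (c 4), c 1 - τ (c 0), c 2 - τ (c 1), c 3 - τ (c 2),
        c 4 - τ (c 3)] i) • (ψ ^ (i : ℕ)) a = 0 := by
      have : u - u = 0 := sub_self u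
      nth_rewrite 1 [e1] at this
      rw [e2] at this
      rw [Fin.sum_univ_five, ← this]
      change (c 0 - τ (c 4)) • a + (c 1 - τ (c 0)) • ψ a + (c 2 - τ (c 1)) • ψ (ψ a)
        + (c 3 - τ (c 2)) • ψ (ψ (ψ a)) + (c 4 - τ (c 3)) • ψ (ψ (ψ (ψ a))) = _
      module
    have hall := Fintype.linearIndependent_iff.1 ha _ hzero
    have h1 : c 1 = τ (c 0) := sub_eq_zero.1 (hall 1)
    have h2 : c 2 = τ (c 1) := sub_eq_zero.1 (hall 2)
    have h3 : c 3 = τ (c 2) := sub_eq_zero.1 (hall 3)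
    have h4 : c 4 = τ (c 3) := sub_eq_zero.1 (hall 4)
    refine ⟨c 0, ?_⟩
    rw [← h1, ← h2, ← h3, ← h4]
    exact e1
  · rintro ⟨x, rfl⟩
    simp only [map_add, h.map_smul, h.iterate_five, gal_iterate_five hFK]
    abel

/-- If `G` has no nonzero vector with its first two images under `ψ` or under `ψ²` in `G`, then the
points of `G` in its images under powers of `ψ` are not collinear. -/
theorem linearIndependent_of_mem (h : IsSemilinearAut τ ψ) (hFK : Module.finrank F K = 5)
    (hV : Module.finrank K V = 5) {G : Submodule K V} (hG : IsScatteredVertex ψ G)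
    (h1 : ∀ r ∈ G, ψ r ∈ G → ψ (ψ r) ∈ G → r = 0)
    (h2 : ∀ r ∈ G, ψ (ψ r) ∈ G → ψ (ψ (ψ (ψ r))) ∈ G → r = 0)
    {a b : V} (ha : a ≠ 0) (hb : b ≠ 0) (ha0 : a ∈ G) (ha1 : ψ a ∈ G)
    (hb2 : ψ (ψ b) ∈ G) : LinearIndependent K ![a, ψ a, b] := by
  have hψ0 : ∀ v, v ≠ 0 → ψ v ≠ 0 := fun v hv h0 => hv (h.injective (by rw [h0, map_zero]))
  have haψ : ∀ c : K, ψ a ≠ c • a := by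
    intro c hc
    refine ha (h1 a ha0 ha1 ?_)
    rw [hc, h.map_smul]
    exact G.smul_mem _ ha1
  have hbab : ∀ α β : K, b ≠ α • a + β • ψ a := by
    intro α β hbe
    have hb2' : τ (τ α) • ψ (ψ a) + τ (τ β) • ψ (ψ (ψ a)) ∈ G := by
      simpa only [hbe, map_add, h.map_smul] using hb2
    by_cases hβ : β = 0
    · subst hβ
      have hα : τ (τ α) ≠ 0 := by
        have : α ≠ 0 := by rintro rfl; simp at hbe; exact hb hbe
        simpa using this
      simp only [map_zero, zero_smul, add_zero] at hb2'
      exact ha (h1 a ha0 ha1 ((G.smul_mem_iff hα).1 hb2'))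
    have hβ2 : τ (τ β) ≠ 0 := by simpa using hβ
    by_cases hα : α = 0
    · subst hα
      simp only [map_zero, zero_smul, zero_add] at hb2'
      refine hψ0 a ha (h2 (ψ a) ha1 ((G.smul_mem_iff hβ2).1 hb2') ?_)
      rwa [h.iterate_five]
    have hα2 : τ (τ α) ≠ 0 := by simpa using hα
    have hli := h.linearIndependent_orbit hFK hG ha ha0 ha1 (Or.inl hα2) hb2'
    have h5 := gal_iterate_five hFK τ
    have h4 := (h.pow hFK (k := 4) (by norm_num)).ne_one
    have hρ : ∀ x, (τ ^ 4) x = τ (τ (τ (τ x))) := fun x => rfl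
    -- Take `ρ = τ ^ 4 = τ⁻¹`: the fixed vector `v x` has coordinates `ρ² x`, `ρ x`, `x` at `ψ² a`,
    -- `ψ³ a`, `ψ⁴ a`. The value of `δ` encodes the ratio of the two coefficients of the vector in
    -- `hb2'`.
    obtain ⟨y, w, t, hy, hw, e1, e2⟩ := exists_common_ratio hFK h4
      (δ := -(τ (τ α) / τ (τ β))) (neg_ne_zero.2 (div_ne_zero hα2 hβ2))
    simp only [hρ, h5] at e1 e2 hw
    set v : K → V := fun x => τ x • a + τ (τ x) • ψ a + τ (τ (τ x)) • ψ (ψ a)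
      + τ (τ (τ (τ x))) • ψ (ψ (ψ a)) + x • ψ (ψ (ψ (ψ a))) with hv
    have hvfix : ∀ x, ψ (v x) = v x := fun x =>
      (h.fixed_iff hFK hV hli).2 ⟨τ x, by rw [hv, h5]⟩
    have hcoord : ∀ c : Fin 5 → K, c 0 • a + c 1 • ψ a + c 2 • ψ (ψ a) + c 3 • ψ (ψ (ψ a))
        + c 4 • ψ (ψ (ψ (ψ a))) = 0 → ∀ i, c i = 0 := by
      intro c hc
      refine Fintype.linearIndependent_iff.1 hli c ?_
      rw [Fin.sum_univ_five]
      exact hc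
    have hv0 : v y ≠ 0 := fun h0 =>
      hy (hcoord ![τ y, τ (τ y), τ (τ (τ y)), τ (τ (τ (τ y))), y] h0 4)
    -- The last coordinate cancels, and the common ratio makes the coordinates at `ψ² a` and `ψ³ a`
    -- proportional to those of the vector in `hb2'`. Scatteredness then forces `τ w = w`, a
    -- contradiction.
    have hmem : v (w * y) - w • v y ∈ G := by
      set d := (τ (τ (τ (τ (w * y)))) - w * τ (τ (τ (τ y)))) / τ (τ β) with hd
      have hd1 : τ (τ (τ (τ (w * y)))) - w * τ (τ (τ (τ y))) = d * τ (τ β) := by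
        rw [hd]; field_simp
      have hd2 : τ (τ (τ (w * y))) - w * τ (τ (τ y)) = d * τ (τ α) := by
        rw [hd]
        field_simp at e1 e2 ⊢
        linear_combination e2 - w * e1
      have : v (w * y) - w • v y = (τ (w * y) - w * τ y) • a
          + (τ (τ (w * y)) - w * τ (τ y)) • ψ a
          + d • (τ (τ α) • ψ (ψ a) + τ (τ β) • ψ (ψ (ψ a))) := by
        have hd3 : d • (τ (τ α) • ψ (ψ a) + τ (τ β) • ψ (ψ (ψ a)))
            = (d * τ (τ α)) • ψ (ψ a) + (d * τ (τ β)) • ψ (ψ (ψ a)) := by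
          rw [smul_add, smul_smul, smul_smul]
        rw [hd3, ← hd1, ← hd2, hv]
        module
      rw [this]
      exact G.add_mem (G.add_mem (G.smul_mem _ ha0) (G.smul_mem _ ha1)) (G.smul_mem _ hb2')
    have heq := hG _ _ w (hvfix _) (hvfix _) hv0 hmem
    have h0 := hcoord ![τ (w * y) - w * τ y, τ (τ (w * y)) - w * τ (τ y),
      τ (τ (τ (w * y))) - w * τ (τ (τ y)), τ (τ (τ (τ (w * y)))) - w * τ (τ (τ (τ y))), 0] (by
        rw [← sub_eq_zero] at heq
        rw [← heq, hv]
        simp only [Matrix.cons_val]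
        module) 0
    have h0' : τ (w * y) - w * τ y = 0 := h0
    have hτw : τ w = w := by
      have hτy : τ y ≠ 0 := by simpa using hy
      rw [map_mul, ← sub_mul] at h0'
      exact sub_eq_zero.1 ((mul_eq_zero.1 h0').resolve_right hτy)
    exact hw (by rw [hτw, hτw, hτw, hτw])
  rw [Fintype.linearIndependent_iff]
  intro g hg
  rw [Fin.sum_univ_three] at hg
  change g 0 • a + g 1 • ψ a + g 2 • b = 0 at hg
  have g2 : g 2 = 0 := by
    by_contra hne
    apply hbab (-((g 2)⁻¹ * g 0)) (-((g 2)⁻¹ * g 1))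
    have : b = (g 2)⁻¹ • (g 2 • b) := by rw [smul_smul, inv_mul_cancel₀ hne, one_smul]
    rw [this, ← sub_eq_zero]
    have h0 : (g 2)⁻¹ • (g 0 • a + g 1 • ψ a + g 2 • b) = 0 := by rw [hg, smul_zero]
    rw [← h0]
    module
  rw [g2, zero_smul, add_zero] at hg
  have g1 : g 1 = 0 := by
    by_contra hne
    apply haψ (-((g 1)⁻¹ * g 0))
    have : ψ a = (g 1)⁻¹ • (g 1 • ψ a) := by rw [smul_smul, inv_mul_cancel₀ hne, one_smul]
    rw [this, ← sub_eq_zero]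
    have h0 : (g 1)⁻¹ • (g 0 • a + g 1 • ψ a) = 0 := by rw [hg, smul_zero]
    rw [← h0]
    module
  rw [g1, zero_smul, add_zero] at hg
  have g0 : g 0 = 0 := (smul_eq_zero.1 hg).resolve_right ha
  intro i
  fin_cases i
  · exact g0
  · exact g1
  · exact g2

variable [IsScalarTower F K V]

omit [Fintype F] in
theorem finrank_restrictScalars (hFK : Module.finrank F K = 5) (W : Submodule K V) :
    Module.finrank F (W.restrictScalars F) = 5 * Module.finrank K W := by
  rw [← hFK]
  exact (Module.finrank_mul_finrank F K W).symm

-- Dimensions are counted over `F`, where `ψ` is linear: `W` and its image have the same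
-- `F`-dimension and both lie in `U`, so they meet.
omit [Fintype F] in
theorem exists_mem_inf_map (h : IsSemilinearAut τ ψ) (hFK : Module.finrank F K = 5)
    (hV : Module.finrank K V = 5) {W U : Submodule K V} (hWU : W ≤ U) (hψU : ∀ w ∈ W, ψ w ∈ U) (hdim : Module.finrank K U
      < 2 * Module.finrank K W) : ∃ v ∈ W, v ≠ 0 ∧ ψ v ∈ W := by
  have : FiniteDimensional F K := .of_finrank_eq_succ hFK
  have : FiniteDimensional K V := .of_finrank_eq_succ hV
  have : FiniteDimensional F V := FiniteDimensional.trans F K V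
  set A := W.restrictScalars F
  set B := A.map ψ
  have hA : Module.finrank F A = 5 * Module.finrank K W := finrank_restrictScalars hFK W
  have hB : Module.finrank F B = 5 * Module.finrank K W := by
    rw [← hA]
    exact (LinearEquiv.finrank_eq (Submodule.equivMapOfInjective ψ h.injective A)).symm
  have hAB : A ⊔ B ≤ U.restrictScalars F := by
    refine sup_le hWU ?_
    rintro _ ⟨w, hw, rfl⟩
    exact hψU w hw
  have h1 := Submodule.finrank_sup_add_finrank_inf_eq A B
  have h2 := Submodule.finrank_mono hAB
  rw [finrank_restrictScalars hFK] at h2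
  have h3 : A ⊓ B ≠ ⊥ := by
    intro h0
    rw [h0, finrank_bot] at h1
    omega
  obtain ⟨x, ⟨hxA, v, hv, rfl⟩, hx0⟩ := Submodule.exists_mem_ne_zero_of_ne_bot h3
  exact ⟨v, hv, fun h0 => hx0 (by rw [h0, map_zero]), hxA⟩

omit [Fintype F] in
/-- Two distinct points of `G` with images under `ψ` in `G` give a point of `G` with its first two
images in `G`. -/
theorem mem_span_of_mem (h : IsSemilinearAut τ ψ) (hFK : Module.finrank F K = 5)
    (hV : Module.finrank K V = 5) {G : Submodule K V} (hG : Module.finrank K G = 3)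
    (h1 : ∀ r ∈ G, ψ r ∈ G → ψ (ψ r) ∈ G → r = 0) {v w : V} (hv0 : v ≠ 0)
    (hv : v ∈ G) (hv1 : ψ v ∈ G) (hw : w ∈ G) (hw1 : ψ w ∈ G) : ∃ c : K, c • v = w := by
  have : FiniteDimensional K V := .of_finrank_eq_succ hV
  by_contra! hne
  have hli : LinearIndependent K ![v, w] := (LinearIndependent.pair_iff' hv0).2 hne
  have hdim : Module.finrank K (Submodule.span K (Set.range ![v, w])) = 2 := by
    rw [finrank_span_eq_card hli]; simp
  set W := Submodule.span K (Set.range ![v, w])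
  have hW : ∀ x ∈ W, x ∈ G ∧ ψ x ∈ G := by
    intro x hx
    have : W = Submodule.span K {v, w} := by simp [W, Set.pair_comm]
    rw [this, Submodule.mem_span_pair] at hx
    obtain ⟨c, d, rfl⟩ := hx
    refine ⟨G.add_mem (G.smul_mem _ hv) (G.smul_mem _ hw), ?_⟩
    rw [map_add, h.map_smul, h.map_smul]
    exact G.add_mem (G.smul_mem _ hv1) (G.smul_mem _ hw1)
  obtain ⟨r, hr, hr0, hr1⟩ := h.exists_mem_inf_map hFK hV (fun x hx => (hW x hx).1)
    (fun x hx => (hW x hx).2) (by omega)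
  exact hr0 (h1 r (hW r hr).1 (hW r hr).2 (hW _ hr1).2)

end IsSemilinearAut

end SemilinearAut

/-! ### Counting vectors of scattered linear sets -/

section Counting

variable {F K W : Type*} [Field F] [Fintype F] [Field K] [Algebra F K]
  [AddCommGroup W] [Module F W] [Module K W] [IsScalarTower F K W]

omit [Fintype F] in
theorem exists_smul_of_isScattered [Finite W] {U : Submodule F W} (hU : IsScatteredSubspace K U)
    {u v : W} (hu : u ∈ U) (hv : v ∈ U) (hv0 : v ≠ 0) {c : K} (huv : u = c • v) :
    ∃ d : F, u = d • v := by
  have h1 := finrank_le_one_iff.1 (hU v)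
  obtain ⟨⟨x, hx⟩, h1⟩ := h1
  have hv' : v ∈ (Submodule.span K {v}).restrictScalars F ⊓ U :=
    ⟨Submodule.mem_span_singleton_self v, hv⟩
  have hu' : u ∈ (Submodule.span K {v}).restrictScalars F ⊓ U :=
    ⟨Submodule.mem_span_singleton.2 ⟨c, huv.symm⟩, hu⟩
  obtain ⟨a, ha⟩ := h1 ⟨v, hv'⟩
  obtain ⟨b, hb⟩ := h1 ⟨u, hu'⟩
  have ha' : a • x = v := congrArg Subtype.val ha
  have hb' : b • x = u := congrArg Subtype.val hb
  have ha0 : a ≠ 0 := by rintro rfl; rw [zero_smul] at ha'; exact hv0 ha'.symm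
  refine ⟨b * a⁻¹, ?_⟩
  rw [← ha', ← hb', smul_smul, mul_assoc, inv_mul_cancel₀ ha0, mul_one]

omit [Fintype F] [Algebra F K] [IsScalarTower F K W] in
theorem mk_mem_linearSet_iff {U : Submodule F W} {v : W} (hv : v ≠ 0) :
    Projectivization.mk K v hv ∈ linearSet K U ↔
      ∃ u ∈ U, u ≠ 0 ∧ Submodule.span K {u} = Submodule.span K {v} := by
  constructor
  · rintro ⟨u, hu, hu0, h⟩
    refine ⟨u, hu, hu0, ?_⟩
    rw [← Projectivization.submodule_mk u hu0, ← Projectivization.submodule_mk v hv, h]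
  · rintro ⟨u, hu, hu0, h⟩
    refine ⟨u, hu, hu0, ?_⟩
    apply Projectivization.submodule_injective
    rw [Projectivization.submodule_mk, Projectivization.submodule_mk, h]

/-- A subspace which defines the same linear set as a scattered subspace of at least the same
dimension is scattered. -/
theorem exists_smul_of_linearSet_eq [Finite W] {U U' : Submodule F W}
    (hUU' : linearSet K U = linearSet K U') (hU' : IsScatteredSubspace K U')
    (hdim : Module.finrank F U ≤ Module.finrank F U')
    {u v : W} (hu : u ∈ U) (hv : v ∈ U) (hv0 : v ≠ 0) {c : K} (huv : u = c • v) :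
    ∃ d : F, u = d • v := by
  classical
  have := Fintype.ofFinite W
  by_contra! hne
  let s : Submodule F W → Finset W := fun X => Finset.univ.filter fun x => x ∈ X ∧ x ≠ 0
  let f : W → Submodule K W := fun x => Submodule.span K {x}
  have hs : ∀ X x, x ∈ s X ↔ x ∈ X ∧ x ≠ 0 := fun X x => by simp [s]
  have hcard : ∀ X : Submodule F W, (s X).card = Fintype.card F ^ Module.finrank F X - 1 := by
    intro X
    have h1 : (Finset.univ.filter fun x => x ∈ X).card = Fintype.card F ^ Module.finrank F X := by
      rw [← Module.card_eq_pow_finrank (K := F) (V := X), Fintype.card_subtype]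
    have h2 : s X = (Finset.univ.filter fun x => x ∈ X).erase 0 := by
      ext x; simp [hs, and_comm]
    rw [h2, Finset.card_erase_of_mem (by simp), h1]
  have hmem : ∀ X p, p ∈ (s X).image f ↔ ∃ x ∈ X, x ≠ 0 ∧ Submodule.span K {x} = p := by
    intro X p
    simp only [Finset.mem_image, hs, f, and_assoc]
  have himage : (s U).image f = (s U').image f := by
    ext p
    rw [hmem, hmem]
    constructor
    · rintro ⟨x, hx, hx0, rfl⟩
      have h1 : Projectivization.mk K x hx0 ∈ linearSet K U := ⟨x, hx, hx0, rfl⟩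
      rw [hUU', mk_mem_linearSet_iff] at h1
      exact h1
    · rintro ⟨x, hx, hx0, rfl⟩
      have h1 : Projectivization.mk K x hx0 ∈ linearSet K U' := ⟨x, hx, hx0, rfl⟩
      rw [← hUU', mk_mem_linearSet_iff] at h1
      exact h1
  let m : W → Finset W := fun x => Finset.univ.image fun d : Fˣ => (d : F) • x
  have hm : ∀ x, x ≠ 0 → (m x).card = Fintype.card Fˣ := by
    intro x hx
    refine Finset.card_image_of_injective _ fun d e hde => ?_
    exact Units.ext (smul_left_injective F hx hde)
  have hspan : ∀ (d : Fˣ) (x : W), f ((d : F) • x) = f x := by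
    intro d x
    have hd : (algebraMap F K d : K) ≠ 0 := by simp
    simp only [f]
    rw [← algebraMap_smul K (d : F) x]
    exact Submodule.span_singleton_smul_eq hd.isUnit x
  have hmU : ∀ X x, x ∈ s X → m x ⊆ (s X).filter fun y => f y = f x := by
    intro X x hx y hy
    obtain ⟨d, _, rfl⟩ := Finset.mem_image.1 hy
    rw [hs] at hx
    rw [Finset.mem_filter, hs]
    exact ⟨⟨X.smul_mem _ hx.1, smul_ne_zero d.ne_zero hx.2⟩, hspan d x⟩
  have hmU' : ∀ x, x ∈ s U' → ((s U').filter fun y => f y = f x) ⊆ m x := by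
    intro x hx y hy
    rw [hs] at hx
    obtain ⟨hy1, hy2⟩ := Finset.mem_filter.1 hy
    rw [hs] at hy1
    have hyx : y ∈ Submodule.span K {x} := by
      change y ∈ f x
      rw [← hy2]
      exact Submodule.mem_span_singleton_self y
    obtain ⟨e, he⟩ := Submodule.mem_span_singleton.1 hyx
    obtain ⟨d, hd⟩ := exists_smul_of_isScattered hU' hy1.1 hx.1 hx.2 he.symm
    have hd0 : d ≠ 0 := by rintro rfl; rw [zero_smul] at hd; exact hy1.2 hd
    exact Finset.mem_image.2 ⟨Units.mk0 d hd0, Finset.mem_univ _, hd.symm⟩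
  -- Over every common point `U'` has exactly `q - 1` nonzero vectors and `U` at least as many; over
  -- the point of `v` it has more, because of `u`.
  have hlt : (s U').card < (s U).card := by
    rw [Finset.card_eq_sum_card_image f (s U'), Finset.card_eq_sum_card_image f (s U), himage]
    have hle' : ∀ p ∈ (s U').image f, ((s U').filter fun y => f y = p).card ≤ Fintype.card Fˣ := by
      intro p hp
      obtain ⟨x, hx, rfl⟩ := Finset.mem_image.1 hp
      rw [← hm x ((hs _ _).1 hx).2]
      exact Finset.card_le_card (hmU' x hx)
    have hle : ∀ p ∈ (s U').image f, Fintype.card Fˣ ≤ ((s U).filter fun y => f y = p).card := by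
      intro p hp
      rw [← himage] at hp
      obtain ⟨x, hx, rfl⟩ := Finset.mem_image.1 hp
      rw [← hm x ((hs _ _).1 hx).2]
      exact Finset.card_le_card (hmU U x hx)
    have hvs : v ∈ s U := (hs _ _).2 ⟨hv, hv0⟩
    have hu0 : u ≠ 0 := by rintro rfl; exact hne 0 (by simp)
    have hus : u ∈ s U := (hs _ _).2 ⟨hu, hu0⟩
    refine Finset.sum_lt_sum (fun p hp => (hle' p hp).trans (hle p hp)) ⟨f v, ?_, ?_⟩
    · rw [← himage]; exact Finset.mem_image_of_mem f hvs
    · refine (hle' _ (by rw [← himage]; exact Finset.mem_image_of_mem f hvs)).trans_lt ?_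
      rw [← hm v hv0]
      refine Finset.card_lt_card ⟨hmU U v hvs, fun hsub => ?_⟩
      have hc : c ≠ 0 := by rintro rfl; rw [zero_smul] at huv; exact hu0 huv
      have : u ∈ m v := hsub (Finset.mem_filter.2 ⟨hus, by
        simp only [f, huv]; exact Submodule.span_singleton_smul_eq hc.isUnit v⟩)
      obtain ⟨d, _, hd⟩ := Finset.mem_image.1 this
      exact hne d hd.symm
  rw [hcard, hcard] at hlt
  have := Nat.pow_le_pow_right (n := Fintype.card F) Fintype.card_pos hdim
  omega

/-- A plane over `K` has a scattered subspace of dimension `[K : F] = 5`. -/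
theorem exists_isScatteredSubspace (hFK : Module.finrank F K = 5) (hW : Module.finrank K W = 2) :
    ∃ U : Submodule F W, IsScatteredSubspace K U ∧ Module.finrank F U = 5 := by
  have : FiniteDimensional K W := .of_finrank_eq_succ hW
  have : FiniteDimensional F K := .of_finrank_eq_succ hFK
  obtain ⟨Fr, hFr, hFrq⟩ := exists_frobenius (F := F) (K := K) hFK
  let e : (K × K) ≃ₗ[K] W := LinearEquiv.ofFinrankEq _ _ (by simp [hW])
  -- The graph of Frobenius: two proportional vectors differ by a factor fixed by Frobenius, hence
  -- lying in `F`.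
  let g : K →ₗ[F] W := (e.toLinearMap.restrictScalars F).comp (LinearMap.prod LinearMap.id
    Fr.toLinearMap)
  have hg : ∀ x, g x = e (x, Fr x) := fun x => rfl
  have hginj : Function.Injective g := by
    intro x y hxy
    rw [hg, hg] at hxy
    exact congrArg Prod.fst (e.injective hxy)
  refine ⟨LinearMap.range g, ?_, by rw [LinearMap.finrank_range_of_inj hginj, hFK]⟩
  intro v
  rw [finrank_le_one_iff]
  by_cases hbot : ∃ x : K, x ≠ 0 ∧ g x ∈ Submodule.span K {v}
  · obtain ⟨x, hx0, hx⟩ := hbot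
    refine ⟨⟨g x, hx, x, rfl⟩, ?_⟩
    rintro ⟨_, hy, y, rfl⟩
    obtain ⟨c, hc⟩ := Submodule.mem_span_singleton.1 hx
    obtain ⟨d, hd⟩ := Submodule.mem_span_singleton.1 hy
    have hc0 : c ≠ 0 := by
      rintro rfl
      rw [zero_smul] at hc
      exact hx0 (hginj (by rw [← hc, map_zero]))
    have hyx : g y = (d / c) • g x := by
      rw [← hd, ← hc, smul_smul, div_mul_cancel₀ _ hc0]
    rw [hg, hg, ← map_smul] at hyx
    have h1 := e.injective hyx
    have h2 : y = d / c * x := congrArg Prod.fst h1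
    have h3 : Fr y = d / c * Fr x := congrArg Prod.snd h1
    have h4 : Fr (d / c) = d / c := by
      rw [h2, map_mul] at h3
      exact mul_right_cancel₀ (by simpa using hx0) h3
    obtain ⟨b, hb⟩ := exists_algebraMap_of_fixed hFK hFr h4
    refine ⟨b, Subtype.ext ?_⟩
    change b • g x = g y
    rw [← map_smul, h2, ← hb, Algebra.smul_def]
  · refine ⟨0, ?_⟩
    rintro ⟨_, hy, y, rfl⟩
    refine ⟨0, Subtype.ext ?_⟩
    by_contra hne
    refine hbot ⟨y, ?_, hy⟩
    rintro rfl
    simp at hne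

end Counting

theorem linearSet_map {F K W W' : Type*} [Field F] [Field K] [Algebra F K]
    [AddCommGroup W] [Module F W] [Module K W] [IsScalarTower F K W]
    [AddCommGroup W'] [Module F W'] [Module K W'] [IsScalarTower F K W']
    (e : W ≃ₗ[K] W') (U : Submodule F W) :
    linearSet K (U.map ((e : W →ₗ[K] W').restrictScalars F)) =
      Projectivization.map (e : W →ₗ[K] W') e.injective '' linearSet K U := by
  ext P
  constructor
  · rintro ⟨_, ⟨v, hv, rfl⟩, hv0, rfl⟩
    have hv0' : v ≠ 0 := by rintro rfl; simp at hv0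
    exact ⟨Projectivization.mk K v hv0', ⟨v, hv, hv0', rfl⟩, rfl⟩
  · rintro ⟨_, ⟨v, hv, hv0, rfl⟩, rfl⟩
    exact ⟨e v, ⟨v, hv, rfl⟩, by simpa using hv0, rfl⟩

/-! ### From the collineation to a semilinear map of order five -/

section Collineation

variable {F K : Type*} [Field F] [Fintype F] [Field K] [Algebra F K]

/-- A nontrivial semilinear collineation fixing a canonical subgeometry `S` pointwise is induced by
a semilinear map of order five whose fixed vectors define `S`. -/
theorem exists_isSemilinearAut (hFK : Module.finrank F K = 5)
    {S : Set (ℙ K (Fin 5 → K))} (hS : IsCanonicalSubgeometry F S)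
    {σ : Equiv.Perm (ℙ K (Fin 5 → K))} (hσ : IsSemilinearCollineation σ)
    (hσS : ∀ P ∈ S, σ P = P) (hσ1 : σ ≠ 1) :
    ∃ (τ : K ≃ₐ[F] K) (ψ : Module.End F (Fin 5 → K)) (R : Submodule F (Fin 5 → K)),
      IsSemilinearAut τ ψ ∧
      (∀ v hv hv', σ (Projectivization.mk K v hv) = Projectivization.mk K (ψ v) hv') ∧
      (∀ u, u ∈ R ↔ ψ u = u) ∧ Module.finrank F R = 5 ∧ S = linearSet K R := by
  obtain ⟨g, hS⟩ := hS
  obtain ⟨τ₀, f, hf, hσf⟩ := hσ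
  set R := (LinearMap.range ((Algebra.linearMap F K).compLeft (Fin 5))).map
    ((g : (Fin 5 → K) →ₗ[K] (Fin 5 → K)).restrictScalars F) with hR
  rw [← linearSet_map, ← hR] at hS
  have hRmem : ∀ x : Fin 5 → F, g (fun i => algebraMap F K (x i)) ∈ R := fun x =>
    ⟨_, ⟨x, rfl⟩, rfl⟩
  have heig : ∀ v ∈ R, v ≠ 0 → ∃ c : K, f v = c • v := by
    intro v hv hv0
    have h1 := hσS _ (by rw [hS]; exact ⟨v, hv, hv0, rfl⟩ : Projectivization.mk K v hv0 ∈ S)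
    rw [hσf, Projectivization.map_mk, Projectivization.mk_eq_mk_iff'] at h1
    obtain ⟨c, hc⟩ := h1
    exact ⟨c, hc.symm⟩
  set b : Fin 5 → (Fin 5 → K) := fun i => g (Pi.single i 1) with hb
  have hcomb : ∀ (i j : Fin 5) (c d : F), algebraMap F K c • b i + algebraMap F K d • b j ∈ R := by
    intro i j c d
    have : algebraMap F K c • b i + algebraMap F K d • b j
        = c • b i + d • b j := by simp only [algebraMap_smul]
    have hbR : ∀ i, b i ∈ R := by
      intro i
      have : b i = g (fun k => algebraMap F K ((Pi.single i 1 : Fin 5 → F) k)) := by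
        refine congrArg g (funext fun k => ?_)
        by_cases hk : k = i
        · subst hk; simp
        · simp [hk]
      rw [this]; exact hRmem _
    rw [this]
    exact R.add_mem (R.smul_mem _ (hbR i)) (R.smul_mem _ (hbR j))
  have hbli : ∀ (i j : Fin 5), i ≠ j → ∀ c d c' d' : K, c • b i + d • b j = c' • b i + d' • b j →
      c = c' ∧ d = d' := by
    intro i j hij c d c' d' h
    simp only [hb, ← map_smul, ← map_add] at h
    have h := g.injective h
    have h1 := congrFun h i
    have h2 := congrFun h j
    simp [hij, hij.symm] at h1 h2
    exact ⟨h1, h2⟩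
  have hb0 : ∀ i, b i ≠ 0 := by
    intro i h0
    have h := g.injective (h0.trans (map_zero g).symm)
    have := congrFun h i
    simp at this
  have hbμ : ∀ i, ∃ c : K, f (b i) = c • b i := fun i =>
    heig _ (by simpa using hcomb i i 1 0) (hb0 i)
  choose μ hμ using hbμ
  -- Comparing the factor of `b 0 + c b j` with those of `b 0` and `b j` shows that all `μ j` agree
  -- (`c = 1`) and that `τ₀` fixes `F`.
  have hμτ : ∀ (j : Fin 5), 0 ≠ j → ∀ c : F, ∃ d : K, μ 0 = d ∧
      τ₀ (algebraMap F K c) * μ j = d * algebraMap F K c := by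
    intro j hj c
    have h0 : (1 : K) • b 0 + algebraMap F K c • b j ≠ 0 := by
      intro h0
      have := (hbli 0 j hj 1 (algebraMap F K c) 0 0 (by rw [h0]; simp)).1
      simp at this
    obtain ⟨d, hd⟩ := heig _ (by simpa using hcomb 0 j 1 c) h0
    refine ⟨d, ?_⟩
    refine hbli 0 j hj _ _ _ _ (Eq.trans ?_ (hd.trans ?_))
    · rw [map_add, map_smulₛₗ, map_smulₛₗ, hμ, hμ, smul_smul, smul_smul]; simp
    · rw [smul_add, smul_smul, smul_smul, mul_one]
  have hμ0 : ∀ j, μ j = μ 0 := by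
    intro j
    by_cases hj : 0 = j
    · rw [hj]
    · obtain ⟨d, hd, hd'⟩ := hμτ j hj 1
      simpa [← hd] using hd'
  have hμne : μ 0 ≠ 0 := by
    intro h0
    have := hμ 0
    rw [h0, zero_smul] at this
    exact hb0 0 (hf.injective (this.trans (map_zero f).symm))
  have hτF : ∀ c : F, τ₀ (algebraMap F K c) = algebraMap F K c := by
    intro c
    obtain ⟨d, hd, hd'⟩ := hμτ 1 (by decide) c
    rw [hμ0, ← hd, mul_comm] at hd'
    exact mul_left_cancel₀ hμne hd'
  let τ : K ≃ₐ[F] K := AlgEquiv.ofRingEquiv (f := τ₀) hτF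
  let gF : (Fin 5 → K) ≃ₗ[F] (Fin 5 → K) := g.restrictScalars F
  -- Dividing `f` by the common factor `μ 0` leaves `τ` acting on coordinates in the basis `b`, so
  -- its order and fixed vectors are visible.
  let ψ : Module.End F (Fin 5 → K) :=
    gF.toLinearMap ∘ₗ (τ.toLinearMap.compLeft (Fin 5)) ∘ₗ gF.symm.toLinearMap
  have hψg : ∀ y, ψ (g y) = g (fun i => τ (y i)) := by
    intro y
    change g (fun i => τ (g.symm (g y) i)) = _
    rw [g.symm_apply_apply]
  have hfψ : ∀ v, f v = μ 0 • ψ v := by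
    intro v
    obtain ⟨y, rfl⟩ := g.surjective v
    have hgy : ∀ y : Fin 5 → K, g y = ∑ i, y i • b i := by
      intro y
      conv_lhs => rw [pi_eq_sum_univ' y]
      rw [map_sum]
      refine Finset.sum_congr rfl fun i _ => ?_
      rw [map_smul]
    rw [hψg, hgy, hgy, map_sum, Finset.smul_sum]
    refine Finset.sum_congr rfl fun i _ => ?_
    rw [map_smulₛₗ, hμ, hμ0, smul_smul, smul_smul, mul_comm]
    rfl
  have hσψ : ∀ v hv hv', σ (Projectivization.mk K v hv) = Projectivization.mk K (ψ v) hv' := by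
    intro v hv hv'
    rw [hσf, Projectivization.map_mk, Projectivization.mk_eq_mk_iff']
    exact ⟨μ 0, (hfψ v).symm⟩
  have hτ1 : τ ≠ 1 := by
    intro h1
    apply hσ1
    ext P
    induction P using Projectivization.ind with
    | h v hv =>
      have : ψ v = v := by
        obtain ⟨y, rfl⟩ := g.surjective v
        rw [hψg, h1]; rfl
      rw [hσψ v hv (by rwa [this])]
      simp only [this]
      rfl
  refine ⟨τ, ψ, R, ⟨hτ1, ?_, ?_⟩, hσψ, ?_, ?_, hS⟩
  · intro c v
    obtain ⟨y, rfl⟩ := g.surjective v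
    rw [← map_smul, hψg, hψg, ← map_smul]
    congr 1
    ext i
    simp
  · refine LinearMap.ext fun v => ?_
    obtain ⟨y, rfl⟩ := g.surjective v
    change ψ (ψ (ψ (ψ (ψ (g y))))) = g y
    simp only [hψg, gal_iterate_five hFK]
  · intro u
    constructor
    · rintro ⟨_, ⟨x, rfl⟩, rfl⟩
      change ψ (g (fun i => algebraMap F K (x i))) = g (fun i => algebraMap F K (x i))
      rw [hψg]
      simp
    · intro hu
      obtain ⟨y, rfl⟩ := g.surjective u
      rw [hψg] at hu
      have hy : ∀ i, ∃ c : F, algebraMap F K c = y i := fun i =>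
        exists_algebraMap_of_fixed hFK hτ1 (congrFun (g.injective hu) i)
      choose x hx using hy
      have := hRmem x
      simpa only [hx] using this
  · have h1 : Function.Injective ((Algebra.linearMap F K).compLeft (Fin 5)) := by
      intro x y hxy
      ext i
      exact (algebraMap F K).injective (congrFun hxy i)
    have h2 : Function.Injective ((g : (Fin 5 → K) →ₗ[K] (Fin 5 → K)).restrictScalars F) :=
      g.injective
    rw [hR, ← (Submodule.equivMapOfInjective _ h2 _).finrank_eq,
      LinearMap.finrank_range_of_inj h1]
    simp

end Collineation

/-! ### Projection of linear sets in terms of vectors -/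

section Projection

variable {F K V : Type*} [Field F] [Field K] [Algebra F K]
  [AddCommGroup V] [Module F V] [Module K V] [IsScalarTower F K V]

theorem submodule_span_singleton {v : V} (hv : v ≠ 0) :
    (Projectivization.Subspace.span {Projectivization.mk K v hv}).submodule
      = Submodule.span K {v} := by
  have h : Projectivization.Subspace.span {Projectivization.mk K v hv} =
      (Submodule.span K {v}).projectivization := by
    apply le_antisymm
    · rw [Projectivization.Subspace.span_le_subspace_iff, Set.singleton_subset_iff]
      exact Submodule.mem_span_singleton_self v
    · intro P
      induction P using Projectivization.ind with
      | h w hw =>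
        intro hP
        rw [Submodule.mk_mem_projectivization_iff] at hP
        obtain ⟨c, rfl⟩ := Submodule.mem_span_singleton.1 hP
        apply Projectivization.Subspace.subset_span
        rw [Set.mem_singleton_iff, Projectivization.mk_eq_mk_iff']
        exact ⟨c, rfl⟩
  rw [h]
  exact Projectivization.Subspace.submodule.apply_symm_apply _

/-- The projection of a linear set from a disjoint vertex is the linear set of the projected
subspace. -/
theorem projectionFrom_linearSet {Γ L : Projectivization.Subspace K V}
    (hΓL : IsCompl L.submodule Γ.submodule) (R : Submodule F V) :
    projectionFrom Γ L (linearSet K R) =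
      linearSet K (R.map ((L.submodule.projectionOnto Γ.submodule hΓL).restrictScalars F)) := by
  ext Q
  induction Q using Projectivization.ind with
  | h w hw =>
  have hw' : (w : V) ≠ 0 := by simpa using hw
  have key : ∀ u : V, ∀ hu : u ≠ 0,
      (Projectivization.map L.submodule.subtype L.submodule.injective_subtype
        (Projectivization.mk K w hw) ∈
          Γ ⊔ Projectivization.Subspace.span {Projectivization.mk K u hu}) ↔
      ∃ c : K, w = c • L.submodule.projectionOnto Γ.submodule hΓL u := by
    intro u hu
    rw [Projectivization.map_mk]
    rw [← Projectivization.Subspace.mem_submodule_iff, map_sup, submodule_span_singleton,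
      Submodule.mem_sup]
    constructor
    · rintro ⟨y, hy, z, hz, hyz⟩
      obtain ⟨c, rfl⟩ := Submodule.mem_span_singleton.1 hz
      refine ⟨c, ?_⟩
      have := congrArg (L.submodule.projectionOnto Γ.submodule hΓL) hyz
      rw [map_add, (Submodule.projectionOnto_apply_eq_zero_iff hΓL).2 hy, zero_add,
        map_smul] at this
      rw [this]
      exact (Submodule.projectionOnto_apply_left hΓL w).symm
    · rintro ⟨c, hc⟩
      refine ⟨w - c • u, ?_, c • u, Submodule.smul_mem _ _ (Submodule.mem_span_singleton_self u),
        by simp⟩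
      rw [← Submodule.projectionOnto_apply_eq_zero_iff hΓL, map_sub, map_smul, ← hc,
        Submodule.projectionOnto_apply_left hΓL w, sub_self]
  constructor
  · rintro ⟨_, ⟨u, hu, hu0, rfl⟩, hP⟩
    obtain ⟨c, hc⟩ := (key u hu0).1 hP
    have hπ : L.submodule.projectionOnto Γ.submodule hΓL u ≠ 0 := by
      intro h0; rw [h0, smul_zero] at hc; exact hw hc
    exact ⟨_, ⟨u, hu, rfl⟩, hπ, (Projectivization.mk_eq_mk_iff' K _ _ hw hπ).2 ⟨c, hc.symm⟩⟩
  · rintro ⟨_, ⟨u, hu, rfl⟩, hu0, hP⟩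
    obtain ⟨c, hc⟩ := (Projectivization.mk_eq_mk_iff' K _ _ hw hu0).1 hP
    have hu0' : u ≠ 0 := by rintro rfl; simp at hu0
    exact ⟨_, ⟨u, hu, hu0', rfl⟩, (key u hu0').2 ⟨c, hc.symm⟩⟩

end Projection

/-! ### Vertices of maximum scattered linear sets -/

section Vertex

variable {F K V : Type*} [Field F] [Fintype F] [Field K] [Algebra F K]
  [AddCommGroup V] [Module F V] [Module K V] [IsScalarTower F K V]

/-- If the vertex of the projection contains a point with its first two images under `ψ`, then the
projected linear set is of pseudoregulus type. -/
theorem isPseudoregulusType_of_mem (hFK : Module.finrank F K = 5)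
    (hV : Module.finrank K V = 5) {τ : K ≃ₐ[F] K} {ψ : Module.End F V} (h : IsSemilinearAut τ ψ)
    {G M : Submodule K V} (hMG : IsCompl M G) (hM : Module.finrank K M = 2)
    (hG : IsScatteredVertex ψ G) {R : Submodule F V} (hR : ∀ u, u ∈ R ↔ ψ u = u)
    {r : V} (hr : r ≠ 0) (hr0 : r ∈ G) (hr1 : ψ r ∈ G) (hr2 : ψ (ψ r) ∈ G) :
    IsPseudoregulusType F (linearSet K (R.map ((M.projectionOnto G hMG).restrictScalars F))) := by
  have : FiniteDimensional K V := .of_finrank_eq_succ hV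
  have hli := h.linearIndependent_orbit hFK hG hr hr0 hr1 (α := 1) (β := 0) (Or.inl one_ne_zero)
    (by simpa using hr2)
  obtain ⟨s, hs, hsτ⟩ : ∃ s : ℕ, s.Coprime 5 ∧
      ∀ x, (((FiniteField.frobeniusAlgHom F K) ^ s).toLinearMap) x = τ x := by
    obtain ⟨Fr, hFr, hFrq⟩ := exists_frobenius (F := F) (K := K) hFK
    have hFr' : ∀ x, FiniteField.frobeniusAlgHom F K x = Fr x := fun x => (hFrq x).symm
    rcases exists_gal_eq_frobenius_pow hFK hFr h.ne_one with rfl | rfl | rfl | rfl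
    · exact ⟨1, by norm_num, fun x => by simp [hFrq]⟩
    · exact ⟨2, by norm_num, fun x => by
        simp only [pow_succ, pow_zero, one_mul]
        change FiniteField.frobeniusAlgHom F K (FiniteField.frobeniusAlgHom F K x) = Fr (Fr x)
        simp only [hFr']⟩
    · exact ⟨3, by norm_num, fun x => by
        simp only [pow_succ, pow_zero, one_mul]
        change FiniteField.frobeniusAlgHom F K (FiniteField.frobeniusAlgHom F K
          (FiniteField.frobeniusAlgHom F K x)) = Fr (Fr (Fr x))
        simp only [hFr']⟩
    · exact ⟨4, by norm_num, fun x => by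
        simp only [pow_succ, pow_zero, one_mul]
        change FiniteField.frobeniusAlgHom F K (FiniteField.frobeniusAlgHom F K
          (FiniteField.frobeniusAlgHom F K (FiniteField.frobeniusAlgHom F K x)))
          = Fr (Fr (Fr (Fr x)))
        simp only [hFr']⟩
  set π := M.projectionOnto G hMG
  have hπG : ∀ x ∈ G, π x = 0 := fun x hx => (Submodule.projectionOnto_apply_eq_zero_iff hMG).2 hx
  -- Since `r`, `ψ r`, `ψ² r` project to zero, the images of `ψ³ r` and `ψ⁴ r` are a basis of `M`; a
  -- fixed vector projects to `(z, τ z)` with `z = τ³ x`.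
  let e₀ : (K × K) →ₗ[K] M := LinearMap.coprod (LinearMap.toSpanSingleton K M (π (ψ (ψ (ψ r)))))
    (LinearMap.toSpanSingleton K M (π (ψ (ψ (ψ (ψ r))))))
  have he₀ : ∀ x y, e₀ (x, y) = x • π (ψ (ψ (ψ r))) + y • π (ψ (ψ (ψ (ψ r)))) := by
    intro x y; simp [e₀]
  have hsurj : Function.Surjective e₀ := by
    intro w
    have hspan := hli.span_eq_top_of_card_eq_finrank' (by simp [hV])
    have hmem : (w : V) ∈ Submodule.span K (Set.range fun i : Fin 5 => (ψ ^ (i : ℕ)) r) := by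
      rw [hspan]; trivial
    obtain ⟨c, hc⟩ := (Submodule.mem_span_range_iff_exists_fun K).1 hmem
    have e1 : (w : V) = c 0 • r + c 1 • ψ r + c 2 • ψ (ψ r) + c 3 • ψ (ψ (ψ r))
        + c 4 • ψ (ψ (ψ (ψ r))) := by
      rw [← hc, Fin.sum_univ_five]; rfl
    refine ⟨(c 3, c 4), ?_⟩
    have e2 := congrArg π e1
    simp only [map_add, map_smul, hπG _ hr0, hπG _ hr1, hπG _ hr2, smul_zero, zero_add] at e2
    rw [he₀, ← e2]
    exact Submodule.projectionOnto_apply_left hMG w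
  have hinj : Function.Injective e₀ :=
    (LinearMap.injective_iff_surjective_of_finrank_eq_finrank (by simp [hM])).2 hsurj
  let e : (K × K) ≃ₗ[K] M := LinearEquiv.ofBijective e₀ ⟨hinj, hsurj⟩
  have he : ∀ x y, e (x, y) = x • π (ψ (ψ (ψ r))) + y • π (ψ (ψ (ψ (ψ r)))) := he₀
  refine ⟨s, by rwa [hFK], e, ?_⟩
  rw [linearSetOfMap, ← linearSet_map]
  congr 1
  have hfix : ∀ x : K, π (x • r + τ x • ψ r + τ (τ x) • ψ (ψ r) + τ (τ (τ x)) • ψ (ψ (ψ r))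
      + τ (τ (τ (τ x))) • ψ (ψ (ψ (ψ r)))) = e (τ (τ (τ x)), τ (τ (τ (τ x)))) := by
    intro x
    simp only [map_add, map_smul, hπG _ hr0, hπG _ hr1, hπG _ hr2, smul_zero, zero_add, he]
  ext w
  constructor
  · rintro ⟨u, hu, rfl⟩
    obtain ⟨x, rfl⟩ := (h.fixed_iff hFK hV hli).1 ((hR u).1 hu)
    refine ⟨(τ (τ (τ x)), τ (τ (τ (τ x)))), ?_, (hfix x).symm⟩
    exact (LinearMap.mem_graph_iff _ _).2 (hsτ _).symm
  · rintro ⟨⟨z, z'⟩, hz, rfl⟩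
    have hz' : z' = τ z := ((LinearMap.mem_graph_iff _ _).1 hz).trans (hsτ z)
    subst hz'
    refine ⟨_, (hR _).2 ((h.fixed_iff hFK hV hli).2 ⟨τ (τ z), rfl⟩), ?_⟩
    refine (hfix _).trans ?_
    rw [gal_iterate_five hFK]
    rfl

/-- The vertex of a projection onto a maximum scattered linear set is a scattered vertex. -/
theorem isScatteredVertex_of_isMaximumScattered (hFK : Module.finrank F K = 5)
    {ψ : Module.End F V} {G M : Submodule K V} (hMG : IsCompl M G) (hM : Module.finrank K M = 2)
    {R : Submodule F V} (hR : ∀ u, u ∈ R ↔ ψ u = u) (hR5 : Module.finrank F R = 5)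
    (hRG : ∀ u ∈ R, u ∈ G → u = 0)
    (hmax : IsMaximumScattered F
      (linearSet K (R.map ((M.projectionOnto G hMG).restrictScalars F)))) :
    IsScatteredVertex ψ G := by
  have : FiniteDimensional F K := .of_finrank_eq_succ hFK
  have : Finite K := Module.finite_of_finite F
  have : FiniteDimensional K M := .of_finrank_eq_succ hM
  have : Finite M := Module.finite_of_finite K
  have : FiniteDimensional F R := .of_finrank_eq_succ hR5
  set π := M.projectionOnto G hMG
  obtain ⟨U', hU', hscat, hmax⟩ := hmax
  -- Maximality concerns some `U'` defining the linear set, not necessarily the projection of `R`. A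
  -- scattered subspace of dimension five forces `U'` to have dimension at least five, and the
  -- counting argument transfers scatteredness.
  obtain ⟨U₀, hU₀, hU₀5⟩ := exists_isScatteredSubspace (F := F) hFK hM
  have hdim : Module.finrank F (R.map (π.restrictScalars F)) ≤ Module.finrank F U' :=
    (Submodule.finrank_map_le _ _).trans (by rw [hR5, ← hU₀5]; exact hmax U₀ hU₀)
  intro u v c hu hv hv0 huv
  have hπ0 : π v ≠ 0 := fun h0 => hv0 (hRG v ((hR v).2 hv)
    ((Submodule.projectionOnto_apply_eq_zero_iff hMG).1 h0))
  have hπuv : π u = c • π v := by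
    rw [← sub_eq_zero, ← map_smul, ← map_sub]
    exact (Submodule.projectionOnto_apply_eq_zero_iff hMG).2 huv
  obtain ⟨d, hd⟩ := exists_smul_of_linearSet_eq hU' hscat hdim
    (u := π u) (v := π v) ⟨u, (hR u).2 hu, rfl⟩ ⟨v, (hR v).2 hv, rfl⟩ hπ0 hπuv
  have h1 : u - d • v = 0 := by
    refine hRG _ (R.sub_mem ((hR u).2 hu) (R.smul_mem _ ((hR v).2 hv))) ?_
    rw [← Submodule.projectionOnto_apply_eq_zero_iff hMG]
    change π.restrictScalars F (u - d • v) = 0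
    rw [map_sub, map_smul]
    exact sub_eq_zero.2 hd
  have h2 : algebraMap F K d = c := by
    have h3 : (algebraMap F K d - c) • π v = 0 := by
      rw [sub_smul, algebraMap_smul, ← hd, hπuv, sub_self]
    exact sub_eq_zero.1 ((smul_eq_zero.1 h3).resolve_right hπ0)
  rw [← h2, algebraMap_smul]
  exact sub_eq_zero.1 h1

-- The periods 5 and `k` of a vector fixed by `ψ ^ k` are coprime. This lets every power of `ψ` play
-- the role of `ψ` with the same subgeometry.
omit [Fintype F] [IsScalarTower F K V] in
theorem IsSemilinearAut.fixed_pow_iff {τ : K ≃ₐ[F] K} {ψ : Module.End F V}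
    (h : IsSemilinearAut τ ψ) {k : ℕ} (hk : ¬ 5 ∣ k) (u : V) : (ψ ^ k) u = u ↔ ψ u = u := by
  rw [Module.End.pow_apply]
  constructor
  · intro hu
    have h5 : Function.IsPeriodicPt ψ 5 u := h.iterate_five u
    have hk' : Function.IsPeriodicPt ψ k u := hu
    have h1 := hk'.gcd h5
    have hcop : k.gcd 5 = 1 :=
      Nat.Coprime.symm ((Nat.Prime.coprime_iff_not_dvd (by norm_num)).2 hk)
    rw [hcop] at h1
    exact h1
  · intro hu
    exact Function.iterate_fixed hu k

omit [Fintype F] [IsScalarTower F K V] in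
/-- The common points of a subspace and its image under a power of the collineation induced by `ψ`
in terms of vectors. -/
theorem inter_image_eq_singleton {τ : K ≃ₐ[F] K} {ψ : Module.End F V}
    (h : IsSemilinearAut τ ψ) {σ : Equiv.Perm (ℙ K V)}
    (hσ : ∀ v hv hv', σ (Projectivization.mk K v hv) = Projectivization.mk K (ψ v) hv')
    (Γ : Projectivization.Subspace K V) {j k : ℕ} (hjk : j + k = 5) {a : V} (ha : a ≠ 0)
    (ha0 : a ∈ Γ.submodule) (hak : (ψ ^ k) a ∈ Γ.submodule)
    (huniq : ∀ w ∈ Γ.submodule, (ψ ^ k) w ∈ Γ.submodule → ∃ c : K, c • a = w) :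
    (Γ : Set (ℙ K V)) ∩ ⇑(σ ^ j) '' (Γ : Set (ℙ K V)) = {Projectivization.mk K a ha} := by
  have hψ0 : ∀ (n : ℕ) (v : V), v ≠ 0 → (ψ ^ n) v ≠ 0 := by
    intro n v hv h0
    refine hv ((h.injective.iterate n) ?_)
    rw [← Module.End.pow_apply, h0, ← Module.End.pow_apply, map_zero]
  have hσn : ∀ (n : ℕ) (v : V) (hv : v ≠ 0), (σ ^ n) (Projectivization.mk K v hv) =
      Projectivization.mk K ((ψ ^ n) v) (hψ0 n v hv) := by
    intro n v hv
    induction n with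
    | zero => rfl
    | succ n ih =>
      rw [pow_succ', Equiv.Perm.mul_apply, ih, hσ _ (hψ0 n v hv) (hψ0 1 _ (hψ0 n v hv))]
      simp only [pow_succ', Module.End.mul_apply]
  have hτn : ∀ (n : ℕ) (c : K) (v : V), (ψ ^ n) (c • v) = (τ ^ n) c • (ψ ^ n) v := by
    intro n
    induction n with
    | zero => intro c v; rfl
    | succ n ih =>
      intro c v
      rw [pow_succ', Module.End.mul_apply, ih, h.map_smul, pow_succ']
      rfl
  have hkj : ∀ v, (ψ ^ k) ((ψ ^ j) v) = v := by
    intro v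
    rw [← Module.End.mul_apply, ← pow_add, add_comm, hjk, h.pow_five]; rfl
  have hjk' : ∀ v, (ψ ^ j) ((ψ ^ k) v) = v := by
    intro v
    rw [← Module.End.mul_apply, ← pow_add, hjk, h.pow_five]; rfl
  ext P
  rw [Set.mem_singleton_iff]
  constructor
  · rintro ⟨hP, Q, hQ, hPQ⟩
    induction P using Projectivization.ind with | h v hv =>
    induction Q using Projectivization.ind with | h w hw =>
    rw [hσn, Projectivization.mk_eq_mk_iff'] at hPQ
    obtain ⟨c, hc⟩ := hPQ
    have hc0 : c ≠ 0 := by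
      rintro rfl
      rw [zero_smul] at hc
      exact hψ0 j w hw hc.symm
    -- As `j + k = 5`, `ψ ^ k` inverts `ψ ^ j`: a point lies in the image under `σ ^ j` exactly when
    -- its image under `ψ ^ k` lies in the subspace.
    have hw' : w = (τ ^ k) c • (ψ ^ k) v := by rw [← hτn, hc, hkj]
    have hwG : w ∈ Γ.submodule := (Projectivization.Subspace.mem_submodule_iff Γ hw).2 hQ
    have hvG : v ∈ Γ.submodule := (Projectivization.Subspace.mem_submodule_iff Γ hv).2 hP
    rw [hw', Submodule.smul_mem_iff _ ((map_ne_zero_iff _ (τ ^ k).injective).2 hc0)] at hwG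
    rw [Projectivization.mk_eq_mk_iff']
    exact huniq v hvG hwG
  · rintro rfl
    refine ⟨(Projectivization.Subspace.mem_submodule_iff Γ ha).1 ha0,
      Projectivization.mk K _ (hψ0 k a ha),
      (Projectivization.Subspace.mem_submodule_iff Γ _).1 hak, ?_⟩
    rw [hσn]
    simp only [hjk']

theorem not_mem_of_linearIndependent {K V : Type*} [Field K] [AddCommGroup V] [Module K V]
    {M : Submodule K V} [Module.Finite K M] (hM : Module.finrank K M ≤ 2) {x y z : V}
    (h : LinearIndependent K ![x, y, z]) (hx : x ∈ M) (hy : y ∈ M) : z ∉ M := by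
  intro hz
  have hspan : Submodule.span K (Set.range ![x, y, z]) ≤ M := by
    rw [Submodule.span_le]
    rintro _ ⟨i, rfl⟩
    fin_cases i
    · exact hx
    · exact hy
    · exact hz
  have h1 := Submodule.finrank_mono hspan
  rw [finrank_span_eq_card h, Fintype.card_fin] at h1
  omega

end Vertex

/-! ### The intersection points and the frame -/

theorem mainTheorem7 {F K : Type*} [Field F] [Fintype F] [Field K] [Algebra F K]
    (hFK : Module.finrank F K = 5)
    (S : Set (ℙ K (Fin 5 → K))) (hS : IsCanonicalSubgeometry F S)
    (Γ Λ : Projectivization.Subspace K (Fin 5 → K))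
    (hΓ : Module.finrank K Γ.submodule = 3)
    (hΓS : Disjoint (Γ : Set (ℙ K (Fin 5 → K))) S)
    (hΓΛ : IsCompl Γ Λ)
    (hscat : IsMaximumScattered F (projectionFrom Γ Λ S))
    (hpseudo : ¬ IsPseudoregulusType F (projectionFrom Γ Λ S))
    (σ : Equiv.Perm (ℙ K (Fin 5 → K))) (hσ : IsSemilinearCollineation σ)
    (hσS : ∀ P ∈ S, σ P = P) (hσ1 : σ ≠ 1) :
    ∃ A B : ℙ K (Fin 5 → K),
      (Γ : Set (ℙ K (Fin 5 → K))) ∩ ⇑(σ ^ 4) '' (Γ : Set (ℙ K (Fin 5 → K))) = {A} ∧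
      (Γ : Set (ℙ K (Fin 5 → K))) ∩ ⇑(σ ^ 3) '' (Γ : Set (ℙ K (Fin 5 → K))) = {B} ∧
      IsFrameOfPlane Γ ![A, σ A, B, (σ ^ 2) B] := by
  obtain ⟨τ, ψ, R, h, hσψ, hR, hR5, rfl⟩ := exists_isSemilinearAut hFK hS hσ hσS hσ1
  set G := Γ.submodule
  have hV : Module.finrank K (Fin 5 → K) = 5 := by simp
  have hMG : IsCompl Λ.submodule G :=
    ((Projectivization.Subspace.submodule (K := K) (V := Fin 5 → K)).isCompl hΓΛ).symm
  have hM : Module.finrank K Λ.submodule = 2 := by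
    have := Submodule.finrank_add_eq_of_isCompl hMG
    omega
  rw [projectionFrom_linearSet hMG] at hscat hpseudo
  have hRG : ∀ u ∈ R, u ∈ G → u = 0 := by
    intro u hu huG
    by_contra hu0
    exact Set.disjoint_left.1 hΓS ((Projectivization.Subspace.mem_submodule_iff Γ hu0).1 huG)
      ⟨u, hu, hu0, rfl⟩
  have hG := isScatteredVertex_of_isMaximumScattered hFK hMG hM hR hR5 hRG hscat
  have hGk : ∀ k : ℕ, ¬ 5 ∣ k → IsScatteredVertex (ψ ^ k) G := by
    intro k hk u v c hu hv
    exact hG u v c ((h.fixed_pow_iff hk u).1 hu) ((h.fixed_pow_iff hk v).1 hv)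
  have hnp : ∀ k : ℕ, ¬ 5 ∣ k → ∀ r ∈ G, (ψ ^ k) r ∈ G → (ψ ^ k) ((ψ ^ k) r) ∈ G → r = 0 := by
    intro k hk r hr hr1 hr2
    by_contra hr0
    exact hpseudo (isPseudoregulusType_of_mem hFK hV (h.pow hFK hk) hMG hM (hGk k hk)
      (fun u => (hR u).trans (h.fixed_pow_iff hk u).symm) hr0 hr hr1 hr2)
  have hex : ∀ k : ℕ, ¬ 5 ∣ k → ∃ a ∈ G, a ≠ 0 ∧ (ψ ^ k) a ∈ G ∧
      ∀ w ∈ G, (ψ ^ k) w ∈ G → ∃ c : K, c • a = w := by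
    intro k hk
    obtain ⟨a, ha, ha0, hak⟩ := (h.pow hFK hk).exists_mem_inf_map hFK hV (W := G) (U := ⊤) le_top
      (fun _ _ => trivial) (by rw [finrank_top, hV, hΓ]; norm_num)
    exact ⟨a, ha, ha0, hak, fun w hw hwk =>
      (h.pow hFK hk).mem_span_of_mem hFK hV hΓ (hnp k hk) ha0 ha hak hw hwk⟩
  have hframe : ∀ k : ℕ, ¬ 5 ∣ k → ∀ a b : Fin 5 → K, a ≠ 0 → b ≠ 0 → a ∈ G → (ψ ^ k) a ∈ G →
      (ψ ^ k) ((ψ ^ k) b) ∈ G → LinearIndependent K ![a, (ψ ^ k) a, b] := by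
    intro k hk a b ha hb ha0 ha1 hb2
    refine (h.pow hFK hk).linearIndependent_of_mem hFK hV (hGk k hk) (hnp k hk) ?_ ha hb ha0 ha1 hb2
    -- The second excluded configuration for `ψ ^ k` is the pseudoregulus configuration for `ψ ^
    -- (2k)`.
    have := hnp (k + k) (by omega)
    simpa only [pow_add, Module.End.mul_apply] using this
  obtain ⟨a, ha, ha0, ha1, hauniq⟩ := hex 1 (by norm_num)
  obtain ⟨b, hb, hb0, hb1, hbuniq⟩ := hex 2 (by norm_num)
  refine ⟨Projectivization.mk K a ha0, Projectivization.mk K b hb0,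
    inter_image_eq_singleton h hσψ Γ (k := 1) rfl ha0 ha ha1 hauniq,
    inter_image_eq_singleton h hσψ Γ (k := 2) rfl hb0 hb hb1 hbuniq, ?_⟩
  have h5 := h.iterate_five
  have hψ0 : ∀ v, v ≠ 0 → ψ v ≠ 0 := fun v hv h0 => hv (h.injective (by rw [h0, map_zero]))
  have ha1' : ψ a ∈ G := ha1
  have hb1' : ψ (ψ b) ∈ G := hb1
  have hψa := hψ0 a ha0
  have hψb := hψ0 _ (hψ0 b hb0)
  have hσa : σ (Projectivization.mk K a ha0) = Projectivization.mk K (ψ a) hψa := hσψ _ _ _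
  have hσb : (σ ^ 2) (Projectivization.mk K b hb0) = Projectivization.mk K (ψ (ψ b)) hψb := by
    rw [pow_two, Equiv.Perm.mul_apply, hσψ _ _ (hψ0 b hb0), hσψ _ _ hψb]
  have p4 : ∀ v, (ψ ^ 4) v = ψ (ψ (ψ (ψ v))) := fun v => rfl
  have p3 : ∀ v, (ψ ^ 3) v = ψ (ψ (ψ v)) := fun v => rfl
  have p2 : ∀ v, (ψ ^ 2) v = ψ (ψ v) := fun v => rfl
  -- The four triples come from the exponents 1, 4, 2, 3; the exponents 4 and 3 act as the inverses
  -- of `ψ` and `ψ²`, reversing the pairs `a, ψ a` and `b, ψ² b`.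
  have l1 : LinearIndependent K ![a, ψ a, b] :=
    hframe 1 (by norm_num) a b ha0 hb0 ha ha1 hb1
  have l2 : LinearIndependent K ![ψ a, a, ψ (ψ b)] := by
    have := hframe 4 (by norm_num) (ψ a) (ψ (ψ b)) hψa hψb ha1' (by rwa [p4, h5])
      (by simpa only [p4, h5] using hb)
    rwa [p4, h5] at this
  have l3 : LinearIndependent K ![b, ψ (ψ b), ψ a] :=
    hframe 2 (by norm_num) b (ψ a) hb0 hψa hb hb1 (by simpa only [p2, h5] using ha)
  have l4 : LinearIndependent K ![ψ (ψ b), b, a] := by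
    have := hframe 3 (by norm_num) (ψ (ψ b)) a hψb ha0 hb1' (by rwa [p3, h5])
      (by simpa only [p3, h5] using ha1')
    rwa [p3, h5] at this
  rw [hσa, hσb]
  constructor
  · intro i
    fin_cases i
    · exact (Projectivization.Subspace.mem_submodule_iff Γ _).1 ha
    · exact (Projectivization.Subspace.mem_submodule_iff Γ _).1 ha1'
    · exact (Projectivization.Subspace.mem_submodule_iff Γ _).1 hb
    · exact (Projectivization.Subspace.mem_submodule_iff Γ _).1 hb1'
  · rintro i j k hij hik hjk ⟨M, hMfin, hM2, hsub⟩
    set X : Fin 4 → (Fin 5 → K) := ![a, ψ a, b, ψ (ψ b)]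
    have hmem : ∀ l : Fin 4, l = i ∨ l = j ∨ l = k → X l ∈ M.submodule := by
      intro l hl
      have h1 : (![Projectivization.mk K a ha0, Projectivization.mk K (ψ a) hψa,
          Projectivization.mk K b hb0, Projectivization.mk K (ψ (ψ b)) hψb] : Fin 4 → _) l ∈ M := by
        apply hsub
        rcases hl with rfl | rfl | rfl <;> simp
      fin_cases l
      · exact (Projectivization.Subspace.mem_submodule_iff M ha0).2 h1
      · exact (Projectivization.Subspace.mem_submodule_iff M hψa).2 h1
      · exact (Projectivization.Subspace.mem_submodule_iff M hb0).2 h1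
      · exact (Projectivization.Subspace.mem_submodule_iff M hψb).2 h1
    have n1 : X 0 ∈ M.submodule → X 1 ∈ M.submodule → X 2 ∉ M.submodule :=
      not_mem_of_linearIndependent hM2 l1
    have n2 : X 1 ∈ M.submodule → X 0 ∈ M.submodule → X 3 ∉ M.submodule :=
      not_mem_of_linearIndependent hM2 l2
    have n3 : X 2 ∈ M.submodule → X 3 ∈ M.submodule → X 1 ∉ M.submodule :=
      not_mem_of_linearIndependent hM2 l3
    have n4 : X 3 ∈ M.submodule → X 2 ∈ M.submodule → X 0 ∉ M.submodule :=
      not_mem_of_linearIndependent hM2 l4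
    have hcover : ∀ i j k : Fin 4, i ≠ j → i ≠ k → j ≠ k → ∃ m : Fin 4, ∀ l, l ≠ m →
        l = i ∨ l = j ∨ l = k := by decide
    obtain ⟨m, hm⟩ := hcover i j k hij hik hjk
    have hall : ∀ l, l ≠ m → X l ∈ M.submodule := fun l hl => hmem l (hm l hl)
    fin_cases m
    · exact n3 (hall 2 (by decide)) (hall 3 (by decide)) (hall 1 (by decide))
    · exact n4 (hall 3 (by decide)) (hall 2 (by decide)) (hall 0 (by decide))
    · exact n2 (hall 1 (by decide)) (hall 0 (by decide)) (hall 3 (by decide))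
    · exact n1 (hall 0 (by decide)) (hall 1 (by decide)) (hall 2 (by decide))
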